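/- Let $\Gamma$ be a metrized graph, i.e. a finite connected graph (multiple edges and self-loops allowed) with finite non-empty vertex set $V(\Gamma)$ and finite edge set $E(\Gamma)$, in which each edge $e_i$ is parametrized by a segment $[0,L_i]$ with $L_i>0$. Let $\ell(\Gamma)=\sum_i L_i$, and let $\upsilon(q)$ be the valence of $q$ (the number of directions emanating from $q$). For $y,z\in\Gamma$ let $x\mapsto j_z(x,y)$ be the voltage function: the unique continuous piecewise affine function on $\Gamma$ with Laplacian $\Delta_x j_z(x,y)=\delta_y-\delta_z$ and $j_z(z,y)=0$, where $\Delta f=-\sum_{x}\big(\text{sum of the outgoing slopes of } f \text{ at } x\big)\,\delta_x$. Let $r(x,y)=j_y(x,x)$ be the resistance function. Let $\mu_{\mathrm{can}}$ be the canonical measure of $\Gamma$, i.e. the unique real-valued signed Borel measure $\mu$ on $\Gamma$ of total mass $1$ such that $\int_\Gamma j_\zeta(x,x)\,d\mu(\zeta)$ does not depend on $x\in\Gamma$, and let the tau constant be the constant $\tau(\Gamma)=\frac12\int_\Gamma j_\zeta(x,x)\,d\mu_{\mathrm{can}}(\zeta)$. Suppose that $\Gamma$ is bridgeless: for each edge $e_i$,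 the graph $\Gamma-e_i$ obtained by deleting the interior of $e_i$ is connected. For an edge $e_i$ with end points $p_i,q_i$ and a vertex $p$, let $R_i$ be the resistance between $p_i$ and $q_i$ in $\Gamma-e_i$, and let $R_{c_i,p}=\hat{\jmath}_p(p_i,q_i)$, where $\hat{\jmath}$ is the voltage function of $\Gamma-e_i$. Then for every vertex $p\in V(\Gamma)$, $$\tau(\Gamma)=\frac{\ell(\Gamma)}{12}-\frac16\sum_{q\in V(\Gamma)}(\upsilon(q)-2)\,r(p,q)+\frac13\sum_{e_i\in E(\Gamma)}\frac{L_i}{L_i+R_i}\,R_{c_i,p}.$$ -/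

import Mathlib

open Set Filter Topology MeasureTheory

noncomputable section

/-- A metrized graph with vertex set `V` and edge set `E`: every edge `e` is parametrized by the
segment `[0, len e]`, with `0` glued to the vertex `src e` and `len e` glued to `tgt e`.  Multiple
edges and self-loops are allowed.  Connectedness is the separate predicate
`MetrizedGraph.Connected`, so that edges can be deleted freely. -/
structure MetrizedGraph (V E : Type*) where
  src : E → V
  tgt : E → V
  len : E → ℝ
  len_pos : ∀ e, 0 < len e

namespace MetrizedGraph

variable {V E : Type*}

/-- The graph is non-empty and connected. -/
def Connected (Γ : MetrizedGraph V E) : Prop :=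
  (SimpleGraph.fromRel fun a b : V => ∃ e, Γ.src e = a ∧ Γ.tgt e = b).Connected

/-- The graph `Γ - e`: the interior of the edge `e` is deleted, all vertices are kept. -/
def deleteEdge (Γ : MetrizedGraph V E) (e : E) : MetrizedGraph V {e' : E // e' ≠ e} where
  src e' := Γ.src e'
  tgt e' := Γ.tgt e'
  len e' := Γ.len e'
  len_pos e' := Γ.len_pos e'

/-- Edge connectivity at least two: the graph is connected, and deleting one edge does not
disconnect it. -/
def Bridgeless (Γ : MetrizedGraph V E) : Prop :=
  Γ.Connected ∧ ∀ e, (Γ.deleteEdge e).Connected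

/-- The total length `ℓ(Γ)`. -/
def totalLength [Fintype E] (Γ : MetrizedGraph V E) : ℝ := ∑ e, Γ.len e

/-- The points of `Γ`: the vertices, and the points in the interiors of the edges. -/
inductive Point (Γ : MetrizedGraph V E)
  | vertex (v : V) : Point Γ
  | interior (e : E) (t : ℝ) (ht : t ∈ Ioo 0 (Γ.len e)) : Point Γ

/-- The parametrization of the edge `e`; the parameter `t` is meant to lie in `[0, len e]`. -/
def edgePoint (Γ : MetrizedGraph V E) (e : E) (t : ℝ) : Γ.Point :=
  if h₀ : t ≤ 0 then .vertex (Γ.src e)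
  else if h₁ : Γ.len e ≤ t then .vertex (Γ.tgt e)
  else .interior e t ⟨not_le.mp h₀, not_le.mp h₁⟩

/-- The gluing topology: a set is open iff its preimage under the parametrization
`[0, len e] → Γ` of every edge is open. -/
instance (Γ : MetrizedGraph V E) : TopologicalSpace Γ.Point :=
  ⨆ e, TopologicalSpace.coinduced (fun t : Icc (0 : ℝ) (Γ.len e) => Γ.edgePoint e t) inferInstance

instance (Γ : MetrizedGraph V E) : MeasurableSpace Γ.Point := borel _

instance (Γ : MetrizedGraph V E) : BorelSpace Γ.Point := ⟨rfl⟩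

/-- The directions emanating from a point.  The direction `(e, false)` runs along `e` with
increasing parameter, `(e, true)` with decreasing parameter. A self-loop at a vertex contributes
both of its directions. -/
def directions (Γ : MetrizedGraph V E) : Γ.Point → Set (E × Bool)
  | .vertex v => {d | (if d.2 then Γ.tgt d.1 else Γ.src d.1) = v}
  | .interior e _ _ => {d | d.1 = e}

/-- The valence `υ(x)`: the number of directions emanating from `x`. -/
def valence (Γ : MetrizedGraph V E) (x : Γ.Point) : ℕ := (Γ.directions x).ncard

/-- The point at (small) distance `s` from `x` in the direction `d` of `Γ.directions x`. -/
def ray (Γ : MetrizedGraph V E) : Γ.Point → E × Bool → ℝ → Γ.Point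
  | .vertex _, d, s => Γ.edgePoint d.1 (if d.2 then Γ.len d.1 - s else s)
  | .interior _ t _, d, s => Γ.edgePoint d.1 (if d.2 then t - s else t + s)

/-- `f` is a continuous piecewise affine function on `Γ` with `f z = 0` and Laplacian
`Δ f = δ_y - δ_z`, where `Δ f = -∑ₓ (sum of the outgoing slopes of f at x) δₓ`.  In other words,
`f` is the voltage, with reference voltage `0` at `z`, when unit current enters at `y` and exits
at `z`, the resistance of a segment being its length. -/
def IsVoltage (Γ : MetrizedGraph V E) (z y : Γ.Point) (f : Γ.Point → ℝ) : Prop :=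
  f z = 0 ∧ ∀ x, ∃ slope : E × Bool → ℝ,
    (∀ d ∈ Γ.directions x, ∀ᶠ s in 𝓝[>] (0 : ℝ), f (Γ.ray x d s) = f x + s * slope d) ∧
    -(∑ᶠ d ∈ Γ.directions x, slope d) =
      ({y} : Set Γ.Point).indicator 1 x - ({z} : Set Γ.Point).indicator 1 x

/-- The voltage function `j_z(x, y)`: as a function of `x` it is the unique solution of
`IsVoltage z y` (on a finite connected graph). -/
def voltage (Γ : MetrizedGraph V E) (z x y : Γ.Point) : ℝ :=
  Classical.epsilon (Γ.IsVoltage z y) x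

/-- The resistance function `r(x, y) = j_y(x, x)`. -/
def resistance (Γ : MetrizedGraph V E) (x y : Γ.Point) : ℝ := Γ.voltage y x x

/-- `R_e`: the resistance between the end points of `e` in `Γ - e`. -/
def edgeResistance (Γ : MetrizedGraph V E) (e : E) : ℝ :=
  (Γ.deleteEdge e).resistance (.vertex (Γ.src e)) (.vertex (Γ.tgt e))

/-- `R_{c_e, p} = ĵ_p(p_e, q_e)`, where `p_e`, `q_e` are the end points of `e` and `ĵ` is the
voltage function of `Γ - e`. -/
def resistanceC (Γ : MetrizedGraph V E) (e : E) (p : V) : ℝ :=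
  (Γ.deleteEdge e).voltage (.vertex p) (.vertex (Γ.src e)) (.vertex (Γ.tgt e))

/-- `j_μ(x, y) = ∫ j_ζ(x, y) dμ(ζ)` for a signed Borel measure `μ`. -/
def measureVoltage (Γ : MetrizedGraph V E) (μ : SignedMeasure Γ.Point) (x y : Γ.Point) : ℝ :=
  ∫ᵛ ζ, Γ.voltage ζ x y ∂•μ

/-- `μ` is a real-valued signed Borel measure of total mass `1` (a `SignedMeasure` always has
finite total variation) for which `j_μ(x, x)` is constant on `Γ`. -/
def IsCanonicalMeasure (Γ : MetrizedGraph V E) (μ : SignedMeasure Γ.Point) : Prop :=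
  μ univ = 1 ∧ ∃ c : ℝ, ∀ x, Γ.measureVoltage μ x x = c

/-- The canonical measure `μ_can`. -/
def canonicalMeasure (Γ : MetrizedGraph V E) : SignedMeasure Γ.Point :=
  Classical.epsilon Γ.IsCanonicalMeasure

/-- The tau constant `τ(Γ)`: the value of the constant function `x ↦ ½ j_{μ_can}(x, x)`. -/
def tau (Γ : MetrizedGraph V E) : ℝ :=
  Classical.epsilon fun t : ℝ => ∀ x, (1 / 2) * Γ.measureVoltage Γ.canonicalMeasure x x = t

end MetrizedGraph

end

/-! ### Discrete potential theory on the vertices. -/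

noncomputable section

/-! Everything is expressed through one function: the Green function `G` of the weighted graph
Laplacian, normalized to vanish at `p`. Interpolating it along the edges and adding the Dirichlet
kernel of each edge gives a Green function `g` on all of Γ (`pointGreen`). Voltages are determined
by their Laplacian and their zero (`Connected.eq_of_hasLaplacian_zero`), so j_z(x,y) = g(x,y) -
g(x,z) - g(z,y) + g(z,z) and r(x,y) = g(x,x) - 2g(x,y) + g(y,y).

Let r_e be the resistance in Γ between the end points of e. The measure μ with mass 1 - υ(v)/2 at v
and density (1 - r_e/L_e)/L_e on e satisfies g(x,x) = 2∫g(x,ζ)dμ(ζ): on vertices both sides have the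
same Laplacian and vanish at `p` (`diag_eq`), and inside an edge the quadratic terms agree. Hence
∫r(x,ζ)dμ(ζ) = ∫g(ζ,ζ)dμ(ζ) for every x. Integrating r against μ and any other canonical measure, in
both orders, shows that the constant is the same for all canonical measures, so τ = ½∫g(ζ,ζ)dμ(ζ)
(`tau_eq`).

Deleting an edge is a rank-one perturbation of the Laplacian, which gives `R_i` and `R_{c_i,p}` in
terms of `G` (`IsGreen.deleteEdge`). The sum of the G(v,v) is also a sum over edges (`sum_diag`),
after which the formula holds edge by edge (`tau_identity`). -/

open scoped Classical in
/-- The Kronecker delta. -/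
def kronecker {V : Type*} (a b : V) : ℝ := if a = b then 1 else 0

theorem kronecker_self {V : Type*} (a : V) : kronecker a a = 1 := by simp [kronecker]

theorem kronecker_comm {V : Type*} (a b : V) : kronecker a b = kronecker b a := by
  unfold kronecker; congr 1; exact propext eq_comm

theorem sum_mul_kronecker {V : Type*} [Fintype V] (f : V → ℝ) (a : V) :
    ∑ v, f v * kronecker a v = f a := by
  classical
  simp [kronecker]

theorem sum_kronecker {V : Type*} [Fintype V] (a : V) : ∑ v, kronecker a v = 1 := by
  simpa using sum_mul_kronecker (fun _ => 1) a

namespace MetrizedGraph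

open scoped Classical

variable {V E : Type*} [Fintype V] [Fintype E] {Γ : MetrizedGraph V E} {p : V} {G : V → V → ℝ}

/-- The Laplacian of the weighted graph with conductances `1 / len e`. -/
def laplacian (Γ : MetrizedGraph V E) (φ : V → ℝ) (v : V) : ℝ :=
  ∑ e, (φ (Γ.src e) - φ (Γ.tgt e)) / Γ.len e * (kronecker (Γ.src e) v - kronecker (Γ.tgt e) v)

omit [Fintype V] in
theorem laplacian_add (φ ψ : V → ℝ) (v : V) :
    Γ.laplacian (fun u => φ u + ψ u) v = Γ.laplacian φ v + Γ.laplacian ψ v := by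
  simp only [laplacian, ← Finset.sum_add_distrib]
  exact Finset.sum_congr rfl fun e _ => by ring

omit [Fintype V] in
theorem laplacian_sub (φ ψ : V → ℝ) (v : V) :
    Γ.laplacian (fun u => φ u - ψ u) v = Γ.laplacian φ v - Γ.laplacian ψ v := by
  simp only [laplacian, ← Finset.sum_sub_distrib]
  exact Finset.sum_congr rfl fun e _ => by ring

omit [Fintype V] in
theorem laplacian_const_mul (c : ℝ) (φ : V → ℝ) (v : V) :
    Γ.laplacian (fun u => c * φ u) v = c * Γ.laplacian φ v := by
  simp only [laplacian, Finset.mul_sum]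
  exact Finset.sum_congr rfl fun e _ => by ring

omit [Fintype V] in
theorem laplacian_sum {ι : Type*} (s : Finset ι) (φ : ι → V → ℝ) (v : V) :
    Γ.laplacian (fun u => ∑ i ∈ s, φ i u) v = ∑ i ∈ s, Γ.laplacian (φ i) v := by
  simp only [laplacian]
  rw [Finset.sum_comm]
  refine Finset.sum_congr rfl fun e _ => ?_
  rw [← Finset.sum_sub_distrib, Finset.sum_div, Finset.sum_mul]

/-- Summation by parts. The right side is symmetric in φ and ψ, whence the symmetry of `G`; for φ =
ψ it is the Dirichlet energy, whence uniqueness. -/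
theorem sum_mul_laplacian (φ ψ : V → ℝ) :
    ∑ v, ψ v * Γ.laplacian φ v =
      ∑ e, (φ (Γ.src e) - φ (Γ.tgt e)) * (ψ (Γ.src e) - ψ (Γ.tgt e)) / Γ.len e := by
  simp only [laplacian, Finset.mul_sum]
  rw [Finset.sum_comm]
  refine Finset.sum_congr rfl fun e _ => ?_
  rw [← sum_mul_kronecker ψ (Γ.src e), ← sum_mul_kronecker ψ (Γ.tgt e),
    ← Finset.sum_sub_distrib, Finset.mul_sum, Finset.sum_div]
  exact Finset.sum_congr rfl fun v _ => by ring

theorem sum_laplacian (φ : V → ℝ) : ∑ v, Γ.laplacian φ v = 0 := by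
  simpa using Γ.sum_mul_laplacian φ 1

omit [Fintype V] [Fintype E] in
theorem Connected.eq_of_forall_edge {α : Type*} (hΓ : Γ.Connected) {φ : V → α}
    (h : ∀ e, φ (Γ.src e) = φ (Γ.tgt e)) (u v : V) : φ u = φ v := by
  obtain ⟨w⟩ := hΓ.preconnected u v
  induction w with
  | nil => rfl
  | cons hadj _ ih =>
    rw [← ih]
    rw [SimpleGraph.fromRel_adj] at hadj
    obtain ⟨-, ⟨e, rfl, rfl⟩ | ⟨e, rfl, rfl⟩⟩ := hadj
    · exact h e
    · exact (h e).symm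

theorem Connected.eq_of_sum_mul_laplacian_eq_zero (hΓ : Γ.Connected) {φ : V → ℝ}
    (h : ∑ v, φ v * Γ.laplacian φ v = 0) (u v : V) : φ u = φ v := by
  refine hΓ.eq_of_forall_edge (fun e => ?_) u v
  rw [sum_mul_laplacian, Finset.sum_eq_zero_iff_of_nonneg] at h
  · have := h e (Finset.mem_univ e)
    simpa [(Γ.len_pos e).ne', sub_eq_zero] using this
  · exact fun e _ => div_nonneg (mul_self_nonneg _) (Γ.len_pos e).le

theorem Connected.eq_of_laplacian_eq_zero (hΓ : Γ.Connected) {φ : V → ℝ}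
    (h : ∀ v, Γ.laplacian φ v = 0) (u v : V) : φ u = φ v :=
  hΓ.eq_of_sum_mul_laplacian_eq_zero (by simp [h]) u v

/-- `G` is the Green function of the discrete Laplacian, normalized to vanish at `p`. -/
structure IsGreen (Γ : MetrizedGraph V E) (p : V) (G : V → V → ℝ) : Prop where
  symm : ∀ u v, G u v = G v u
  base : ∀ v, G p v = 0
  lap : ∀ u v, Γ.laplacian (fun w => G w v) u = kronecker u v - kronecker u p

theorem Connected.exists_isGreen (hΓ : Γ.Connected) (p : V) : ∃ G, Γ.IsGreen p G := by
  -- The Laplacian has the constants as kernel. Adding the rank-one form φ(p)ψ(p) makes it positive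
  -- definite, hence invertible.
  let A : (V → ℝ) →ₗ[ℝ] (V → ℝ) :=
    { toFun := fun φ v => Γ.laplacian φ v + φ p * kronecker p v
      map_add' := fun φ ψ => by
        ext v
        have := Γ.laplacian_add φ ψ v
        simp only [Pi.add_apply]
        change Γ.laplacian (fun u => φ u + ψ u) v + _ = _
        rw [this]; ring
      map_smul' := fun c φ => by
        ext v
        have := Γ.laplacian_const_mul c φ v
        simp only [Pi.smul_apply, smul_eq_mul, RingHom.id_apply]
        change Γ.laplacian (fun u => c * φ u) v + _ = _
        rw [this]; ring }
  have hA : ∀ φ v, A φ v = Γ.laplacian φ v + φ p * kronecker p v := fun _ _ => rfl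
  have hsum : ∀ φ ψ : V → ℝ, ∑ v, ψ v * A φ v = ∑ v, ψ v * Γ.laplacian φ v + φ p * ψ p := by
    intro φ ψ
    rw [← sum_mul_kronecker ψ p, Finset.mul_sum, ← Finset.sum_add_distrib]
    exact Finset.sum_congr rfl fun v _ => by rw [hA]; ring
  have hinj : Function.Injective A := by
    rw [← LinearMap.ker_eq_bot, LinearMap.ker_eq_bot']
    intro φ h0
    have h := hsum φ φ
    simp only [h0, Pi.zero_apply, mul_zero, Finset.sum_const_zero] at h
    have hn : 0 ≤ ∑ v, φ v * Γ.laplacian φ v := by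
      rw [sum_mul_laplacian]
      exact Finset.sum_nonneg fun e _ => div_nonneg (mul_self_nonneg _) (Γ.len_pos e).le
    have hp : φ p = 0 := by nlinarith [mul_self_nonneg (φ p)]
    ext v
    rw [hΓ.eq_of_sum_mul_laplacian_eq_zero (φ := φ) (by nlinarith [mul_self_nonneg (φ p)]) v p, hp]
    rfl
  have hsurj : Function.Surjective A := LinearMap.injective_iff_surjective.mp hinj
  choose H hH using fun v => hsurj (kronecker v)
  -- Pairing with the constant 1 kills the Laplacian and leaves the value at `p`; so `H - 1` is the
  -- normalized Green function.
  have hHp : ∀ v, H v p = 1 := by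
    intro v
    have := hsum (H v) 1
    simpa [hH, sum_kronecker, sum_laplacian] using this.symm
  have hsymm : ∀ u v, H u v = H v u := by
    intro u v
    have h1 := hsum (H u) (H v)
    have h2 := hsum (H v) (H u)
    rw [hH, sum_mul_kronecker, sum_mul_laplacian] at h1 h2
    rw [h1, h2]
    simp only [mul_comm]
  refine ⟨fun u v => H v u - 1, fun u v => by rw [hsymm], fun v => by simp [hHp], fun u v => ?_⟩
  have h := congrFun (hH v) u
  rw [hA, hHp, one_mul] at h
  rw [laplacian_sub, kronecker_comm u v, kronecker_comm u p, ← h]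
  simp [laplacian]

/-- The effective resistance between the end points of `e`, in terms of a Green function. -/
def edgeGap (Γ : MetrizedGraph V E) (G : V → V → ℝ) (e : E) : ℝ :=
  G (Γ.src e) (Γ.src e) - 2 * G (Γ.src e) (Γ.tgt e) + G (Γ.tgt e) (Γ.tgt e)

omit [Fintype V] in
theorem laplacian_deleteEdge (e : E) (φ : V → ℝ) (v : V) :
    (Γ.deleteEdge e).laplacian φ v = Γ.laplacian φ v -
      (φ (Γ.src e) - φ (Γ.tgt e)) / Γ.len e *
        (kronecker (Γ.src e) v - kronecker (Γ.tgt e) v) := by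
  classical
  rw [eq_sub_iff_add_eq, add_comm, laplacian, laplacian, deleteEdge]
  exact (Fintype.sum_eq_add_sum_subtype_ne (fun e => (φ (Γ.src e) - φ (Γ.tgt e)) / Γ.len e *
    (kronecker (Γ.src e) v - kronecker (Γ.tgt e) v)) e).symm

/-- The degree of `v`, as a real number. -/
def degree (Γ : MetrizedGraph V E) (v : V) : ℝ :=
  ∑ e, (kronecker (Γ.src e) v + kronecker (Γ.tgt e) v)

theorem sum_degree_mul (f : V → ℝ) :
    ∑ v, Γ.degree v * f v = ∑ e, (f (Γ.src e) + f (Γ.tgt e)) := by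
  simp only [degree, Finset.sum_mul]
  rw [Finset.sum_comm]
  refine Finset.sum_congr rfl fun e _ => ?_
  rw [← sum_mul_kronecker f (Γ.src e), ← sum_mul_kronecker f (Γ.tgt e), ← Finset.sum_add_distrib]
  exact Finset.sum_congr rfl fun v _ => by ring

namespace IsGreen

omit [Fintype V] in
-- The dipole potential of e stays a dipole potential after deletion, with strength reduced by the
-- current `edgeGap / len` that flowed through e.
theorem laplacian_deleteEdge_sub (hG : Γ.IsGreen p G) (e : E) (v : V) :
    (Γ.deleteEdge e).laplacian (fun u => G u (Γ.src e) - G u (Γ.tgt e)) v =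
      (1 - Γ.edgeGap G e / Γ.len e) * (kronecker (Γ.src e) v - kronecker (Γ.tgt e) v) := by
  rw [laplacian_deleteEdge, laplacian_sub, hG.lap, hG.lap, hG.symm (Γ.tgt e) (Γ.src e), edgeGap,
    kronecker_comm v (Γ.src e), kronecker_comm v (Γ.tgt e)]
  ring

/-- Under equality the dipole potential would be harmonic on the connected graph Γ - e, hence
constant, and `edgeGap` would be 0. This is where bridgelessness enters. -/
theorem edgeGap_ne_len (hG : Γ.IsGreen p G) {e : E} (he : (Γ.deleteEdge e).Connected) :
    Γ.edgeGap G e ≠ Γ.len e := by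
  intro h
  have hL := Γ.len_pos e
  have hw := he.eq_of_laplacian_eq_zero (φ := fun u => G u (Γ.src e) - G u (Γ.tgt e))
    (fun v => by rw [hG.laplacian_deleteEdge_sub, h, div_self hL.ne']; ring) (Γ.src e) (Γ.tgt e)
  simp only [hG.symm (Γ.tgt e) (Γ.src e)] at hw
  rw [edgeGap] at h
  linarith

/-- The Sherman–Morrison formula: a multiple of the dipole potential makes up for the lost current,
and 1/(L - r)·(1 - r/L) = 1/L fixes the coefficient. -/
theorem deleteEdge (hG : Γ.IsGreen p G) {e : E} (he : (Γ.deleteEdge e).Connected) :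
    (Γ.deleteEdge e).IsGreen p fun u v => G u v +
      (G v (Γ.src e) - G v (Γ.tgt e)) / (Γ.len e - Γ.edgeGap G e) *
        (G u (Γ.src e) - G u (Γ.tgt e)) where
  symm u v := by rw [hG.symm u v]; ring
  base v := by simp [hG.base]
  lap u v := by
    have hne := sub_ne_zero.mpr (hG.edgeGap_ne_len he).symm
    have hL := (Γ.len_pos e).ne'
    rw [laplacian_add, laplacian_const_mul, hG.laplacian_deleteEdge_sub, laplacian_deleteEdge,
      hG.lap, hG.symm (Γ.src e) v, hG.symm (Γ.tgt e) v]
    field_simp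
    ring

omit [Fintype V] in
-- For an edge from u to w, 2(G(u,u) - G(w,u)) - (G(u,u) - G(w,w)) is exactly the gap of the edge.
-- Self-loops contribute zero.
theorem laplacian_diag (hG : Γ.IsGreen p G) (u : V) :
    Γ.laplacian (fun v => G v v) u = 2 - 2 * kronecker u p -
      ∑ e, Γ.edgeGap G e / Γ.len e * (kronecker (Γ.src e) u + kronecker (Γ.tgt e) u) := by
  have h := congrArg (2 * ·) (hG.lap u u)
  simp only [kronecker_self, mul_sub, mul_one] at h
  rw [← h, laplacian, laplacian, Finset.mul_sum, ← Finset.sum_sub_distrib]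
  refine Finset.sum_congr rfl fun e _ => ?_
  have hs := hG.symm (Γ.src e) (Γ.tgt e)
  have hL := (Γ.len_pos e).ne'
  by_cases ha : Γ.src e = u <;> by_cases hb : Γ.tgt e = u
  · simp [kronecker, edgeGap, ha, hb]; ring_nf; simp
  · subst ha; simp [kronecker, edgeGap, hb, hs]; field_simp; ring
  · subst hb; simp [kronecker, edgeGap, ha, hs]; field_simp; ring
  · simp [kronecker, ha, hb]

/-- Foster's theorem, obtained by summing `laplacian_diag` over all vertices. -/
theorem sum_edgeGap_div (hG : Γ.IsGreen p G) :
    ∑ e, Γ.edgeGap G e / Γ.len e = (∑ _v : V, 1 : ℝ) - 1 := by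
  have h := Γ.sum_laplacian fun v => G v v
  simp only [hG.laplacian_diag, Finset.sum_sub_distrib, ← Finset.mul_sum] at h
  rw [Finset.sum_comm] at h
  simp only [← Finset.mul_sum, Finset.sum_add_distrib, sum_kronecker, kronecker_comm _ p] at h
  rw [← Finset.sum_mul] at h
  have h2 : ∑ _v : V, (2 : ℝ) = 2 * ∑ _v : V, 1 := by rw [Finset.mul_sum]; simp
  linarith

/-- Since G(p,p) = 0, weighting the diagonal by (Δ G(·,v))(v) = 1 - δ_{vp} does not change its sum;
expanding the Laplacian turns it into a sum over edges. -/
theorem sum_diag (hG : Γ.IsGreen p G) :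
    ∑ v, G v v = ∑ e,
      (G (Γ.src e) (Γ.src e) * (G (Γ.src e) (Γ.src e) - G (Γ.src e) (Γ.tgt e)) +
        G (Γ.tgt e) (Γ.tgt e) * (G (Γ.tgt e) (Γ.tgt e) - G (Γ.src e) (Γ.tgt e))) / Γ.len e := by
  have h : ∑ v, G v v = ∑ v, G v v * Γ.laplacian (fun w => G w v) v := by
    simp only [hG.lap, kronecker_self, mul_sub, mul_one, Finset.sum_sub_distrib,
      kronecker_comm _ p, sum_mul_kronecker, hG.base, sub_zero]
  rw [h]
  simp only [laplacian, Finset.mul_sum]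
  rw [Finset.sum_comm]
  refine Finset.sum_congr rfl fun e _ => ?_
  have h1 := sum_mul_kronecker (fun v => G v v * ((G (Γ.src e) v - G (Γ.tgt e) v) / Γ.len e))
  simp only [mul_sub, Finset.sum_sub_distrib, ← mul_assoc] at h1 ⊢
  rw [h1, h1, hG.symm (Γ.tgt e) (Γ.src e)]
  ring

/-- The function `x ↦ ∑ g(x, v) m(v)` over the vertices and edges, `m` being the canonical
measure, differs from the diagonal of the Green function by a constant. -/
theorem diag_eq (hG : Γ.IsGreen p G) (hΓ : Γ.Connected) (u : V) :
    G u u = 2 * ∑ v, (1 - Γ.degree v / 2) * G u v +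
      ∑ e, (1 - Γ.edgeGap G e / Γ.len e) * (G u (Γ.src e) + G u (Γ.tgt e)) := by
  set U : V → ℝ := fun u => 2 * ∑ v, (1 - Γ.degree v / 2) * G u v +
      ∑ e, (1 - Γ.edgeGap G e / Γ.len e) * (G u (Γ.src e) + G u (Γ.tgt e)) with hU
  -- The coefficients of the point mass at `p` match by Foster's theorem; both functions vanish at
  -- `p`, so harmonicity of the difference suffices.
  have key : ∀ u, Γ.laplacian (fun u => G u u - U u) u = 0 := by
    intro u
    rw [laplacian_sub, hG.laplacian_diag, hU, laplacian_add, laplacian_const_mul, laplacian_sum,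
      laplacian_sum]
    simp only [laplacian_const_mul, laplacian_add, hG.lap]
    have h1 : ∑ v, (1 - Γ.degree v / 2) * (kronecker u v - kronecker u p) =
        1 - Γ.degree u / 2 - (∑ _v : V, 1 - ∑ _e : E, 1) * kronecker u p := by
      have hd := Γ.sum_degree_mul fun _ => (1 : ℝ)
      have h3 := sum_mul_kronecker (fun v => 1 - Γ.degree v / 2) u
      simp only [mul_sub, Finset.sum_sub_distrib, ← Finset.sum_mul, h3] at hd ⊢
      simp only [mul_one, ← Finset.sum_div, Finset.sum_add_distrib] at hd ⊢
      rw [hd]; ring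
    have h2 : ∑ e, (1 - Γ.edgeGap G e / Γ.len e) * (kronecker u (Γ.src e) - kronecker u p +
        (kronecker u (Γ.tgt e) - kronecker u p)) = Γ.degree u -
        ∑ e, Γ.edgeGap G e / Γ.len e * (kronecker (Γ.src e) u + kronecker (Γ.tgt e) u) -
        2 * (∑ _e : E, 1 - ∑ e, Γ.edgeGap G e / Γ.len e) * kronecker u p := by
      rw [degree, ← Finset.sum_sub_distrib, ← Finset.sum_sub_distrib, Finset.mul_sum,
        Finset.sum_mul, ← Finset.sum_sub_distrib]
      refine Finset.sum_congr rfl fun e _ => ?_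
      rw [kronecker_comm u (Γ.src e), kronecker_comm u (Γ.tgt e)]
      ring
    rw [h1, h2, hG.sum_edgeGap_div]
    ring
  have h := hΓ.eq_of_laplacian_eq_zero key u p
  simp only [hU, hG.base] at h
  simpa [sub_eq_zero] using h

theorem tau_identity (hG : Γ.IsGreen p G) (hL : ∀ e, Γ.edgeGap G e ≠ Γ.len e) :
    1 / 2 * (∑ v, (1 - Γ.degree v / 2) * G v v + ∑ e, (1 - Γ.edgeGap G e / Γ.len e) *
      ((G (Γ.src e) (Γ.src e) + G (Γ.tgt e) (Γ.tgt e)) / 2 + (Γ.len e - Γ.edgeGap G e) / 6)) =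
    (∑ e, Γ.len e) / 12 - 1 / 6 * ∑ v, (Γ.degree v - 2) * G v v +
      1 / 3 * ∑ e, (1 - Γ.edgeGap G e / Γ.len e) * (G (Γ.src e) (Γ.tgt e) +
        (G (Γ.tgt e) (Γ.src e) - G (Γ.tgt e) (Γ.tgt e)) / (Γ.len e - Γ.edgeGap G e) *
        (G (Γ.src e) (Γ.src e) - G (Γ.src e) (Γ.tgt e))) := by
  have h1 := Γ.sum_degree_mul fun v => G v v
  have h2 := hG.sum_diag
  simp only [sub_mul, Finset.sum_sub_distrib, one_mul, div_mul_eq_mul_div, ← Finset.sum_div,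
    ← Finset.mul_sum, h1]
  rw [h2, ← sub_eq_zero]
  simp only [← Finset.sum_sub_distrib, Finset.sum_div, Finset.mul_sum, ← Finset.sum_add_distrib]
  refine Finset.sum_eq_zero fun e _ => ?_
  have hne := sub_ne_zero.mpr (hL e).symm
  have hl := (Γ.len_pos e).ne'
  rw [hG.symm (Γ.tgt e) (Γ.src e)]
  -- Keeps `L - r` atomic as a denominator; the definition of r is put back once the denominators
  -- are cleared.
  generalize hr : Γ.edgeGap G e = r at *
  rw [edgeGap] at hr
  field_simp
  rw [← hr]
  ring

end IsGreen

end MetrizedGraph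
end

/-! ### Piecewise affine functions, the Green function on all points, and voltages. -/

noncomputable section

/-- Gives the one-sided slopes of the Dirichlet kernel; at the kink a = b only decreasing directions
leave the constant branch. -/
theorem eventually_min_add_mul (a b σ : ℝ) : ∀ᶠ s in 𝓝[>] (0 : ℝ),
    min (a + σ * s) b = min a b + s * (if a < b ∨ a = b ∧ σ < 0 then σ else 0) := by
  have hc : Tendsto (fun s : ℝ => a + σ * s) (𝓝[>] 0) (𝓝 a) := by
    have : Continuous fun s : ℝ => a + σ * s := by fun_prop
    simpa using (this.tendsto 0).mono_left nhdsWithin_le_nhds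
  rcases lt_trichotomy a b with h | h | h
  · filter_upwards [hc.eventually_lt_const h] with s hs
    rw [min_eq_left hs.le, min_eq_left h.le, if_pos (Or.inl h)]
    ring
  · subst h
    filter_upwards [self_mem_nhdsWithin] with s hs
    have hs : 0 < s := hs
    by_cases hσ : σ < 0
    · rw [if_pos (Or.inr ⟨rfl, hσ⟩), min_eq_left (by nlinarith), min_self]
      ring
    · rw [if_neg (by simp [hσ]), min_eq_right (by nlinarith [mul_nonneg (not_lt.mp hσ) hs.le]),
        min_self]
      ring
  · filter_upwards [hc.eventually_const_lt h] with s hs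
    rw [min_eq_right hs.le, min_eq_right h.le, if_neg (by rintro (h' | h') <;> linarith)]
    ring

theorem eq_of_eventually_add_mul_eq {a b c d : ℝ}
    (h : ∀ᶠ s in 𝓝[>] (0 : ℝ), a + s * b = c + s * d) : a = c ∧ b = d := by
  have lim : ∀ x y : ℝ, Tendsto (fun s : ℝ => x + s * y) (𝓝[>] 0) (𝓝 x) := by
    intro x y
    have : Continuous fun s : ℝ => x + s * y := by fun_prop
    simpa using (this.tendsto 0).mono_left nhdsWithin_le_nhds
  have hac : a = c := tendsto_nhds_unique ((lim a b).congr' h) (lim c d)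
  obtain ⟨s, hs, hs0⟩ := (h.and self_mem_nhdsWithin).exists
  refine ⟨hac, mul_left_cancel₀ (ne_of_gt hs0) ?_⟩
  linarith

/-- The derivative is locally constant, hence constant, on the open interval. The one-sided
expansions at the ends give continuity there. -/
theorem eqOn_affine_of_locally_affine {F : ℝ → ℝ} {L : ℝ} (hL : 0 < L)
    (hF : ∀ t ∈ Ioo 0 L, ∃ a, ∀ᶠ u in 𝓝 t, F u = F t + (u - t) * a)
    (h0 : ∃ a, ∀ᶠ s in 𝓝[>] (0 : ℝ), F s = F 0 + s * a)
    (h1 : ∃ a, ∀ᶠ s in 𝓝[>] (0 : ℝ), F (L - s) = F L + s * a) :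
    ∃ a, ∀ t ∈ Icc 0 L, F t = F 0 + t * a := by
  have hder : ∀ t ∈ Ioo 0 L, ∃ a, ∀ᶠ u in 𝓝 t, HasDerivAt F a u := by
    intro t ht
    obtain ⟨a, ha⟩ := hF t ht
    refine ⟨a, ha.eventually_nhds.mono fun u hu => ?_⟩
    refine HasDerivAt.congr_of_eventuallyEq ?_ hu
    simpa using (((hasDerivAt_id u).sub_const t).mul_const a).const_add (F t)
  have hder2 : ∀ t ∈ Ioo 0 L, HasDerivAt (deriv F) 0 t := by
    intro t ht
    obtain ⟨a, ha⟩ := hder t ht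
    exact (hasDerivAt_const t a).congr_of_eventuallyEq (ha.mono fun u hu => hu.deriv)
  have hmid : L / 2 ∈ Ioo 0 L := ⟨by linarith, by linarith⟩
  have hconst : ∀ t ∈ Ioo 0 L, deriv F t = deriv F (L / 2) := fun t ht =>
    isOpen_Ioo.is_const_of_deriv_eq_zero isPreconnected_Ioo
      (fun u hu => (hder2 u hu).differentiableAt.differentiableWithinAt)
      (fun u hu => (hder2 u hu).deriv) ht hmid
  set a := deriv F (L / 2)
  have hd : ∀ t ∈ Ioo 0 L, HasDerivAt (fun u => F u - u * a) 0 t := by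
    intro t ht
    obtain ⟨b, hb⟩ := hder t ht
    have h := hb.self_of_nhds.differentiableAt.hasDerivAt.sub ((hasDerivAt_id t).mul_const a)
    rw [hconst t ht] at h
    simpa using! h
  obtain ⟨c, hc⟩ : ∃ c, ∀ t ∈ Ioo 0 L, F t = c + t * a := by
    refine ⟨F (L / 2) - L / 2 * a, fun t ht => ?_⟩
    have := isOpen_Ioo.is_const_of_deriv_eq_zero isPreconnected_Ioo
      (fun u hu => (hd u hu).differentiableAt.differentiableWithinAt)
      (fun u hu => (hd u hu).deriv) ht hmid
    linarith
  have hsmall : ∀ᶠ s in 𝓝[>] (0 : ℝ), s ∈ Ioo 0 L := Ioo_mem_nhdsGT hL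
  obtain ⟨a0, h0⟩ := h0
  obtain ⟨a1, h1⟩ := h1
  have e0 : F 0 = c := (eq_of_eventually_add_mul_eq (b := a0) (d := a) <| by
    filter_upwards [h0, hsmall] with s hs hs'
    rw [← hs, hc s hs']).1
  have e1 : F L = c + L * a := (eq_of_eventually_add_mul_eq (b := a1) (d := -a) <| by
    filter_upwards [h1, hsmall] with s hs hs'
    rw [← hs, hc (L - s) ⟨by linarith [hs'.2], by linarith [hs'.1]⟩]
    ring).1
  refine ⟨a, fun t ht => ?_⟩
  rcases eq_or_lt_of_le ht.1 with h | h
  · subst h; simp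
  · rcases eq_or_lt_of_le ht.2 with h' | h'
    · subst h'; rw [e1, e0]
    · rw [hc t ⟨h, h'⟩, e0]

namespace MetrizedGraph

open scoped Classical

variable {V E : Type*} {Γ : MetrizedGraph V E} {p : V} {G : V → V → ℝ}

/-- The extension of a function on the vertices which is affine on the edges. -/
def interp (Γ : MetrizedGraph V E) (φ : V → ℝ) : Γ.Point → ℝ
  | .vertex v => φ v
  | .interior e t _ => φ (Γ.src e) + t / Γ.len e * (φ (Γ.tgt e) - φ (Γ.src e))

/-- The sum of the Green functions of the edges with Dirichlet boundary conditions. -/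
def edgeKernel (Γ : MetrizedGraph V E) : Γ.Point → Γ.Point → ℝ
  | .interior e s _, .interior e' t _ => if e = e' then min s t - s * t / Γ.len e else 0
  | _, _ => 0

/-- The extension of a Green function from the vertices to all points. -/
def pointGreen (Γ : MetrizedGraph V E) (G : V → V → ℝ) (x y : Γ.Point) : ℝ :=
  Γ.interp (fun u => Γ.interp (G u) y) x + Γ.edgeKernel x y

theorem edgePoint_zero (e : E) : Γ.edgePoint e 0 = .vertex (Γ.src e) := by simp [edgePoint]

theorem edgePoint_len (e : E) : Γ.edgePoint e (Γ.len e) = .vertex (Γ.tgt e) := by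
  simp [edgePoint, Γ.len_pos e]

theorem edgePoint_of_mem {e : E} {t : ℝ} (ht : t ∈ Ioo 0 (Γ.len e)) :
    Γ.edgePoint e t = .interior e t ht := by
  rw [edgePoint, dif_neg ht.1.not_ge, dif_neg ht.2.not_ge]

theorem edgePoint_cases {e : E} {t : ℝ} (ht : t ∈ Icc 0 (Γ.len e)) :
    t = 0 ∨ t = Γ.len e ∨ t ∈ Ioo 0 (Γ.len e) := by
  rcases eq_or_lt_of_le ht.1 with h | h
  · exact Or.inl h.symm
  · rcases eq_or_lt_of_le ht.2 with h' | h'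
    · exact Or.inr (Or.inl h')
    · exact Or.inr (Or.inr ⟨h, h'⟩)

theorem interp_edgePoint (φ : V → ℝ) {e : E} {t : ℝ} (ht : t ∈ Icc 0 (Γ.len e)) :
    Γ.interp φ (Γ.edgePoint e t) =
      φ (Γ.src e) + t / Γ.len e * (φ (Γ.tgt e) - φ (Γ.src e)) := by
  have hL := (Γ.len_pos e).ne'
  rcases edgePoint_cases ht with rfl | rfl | h
  · simp [edgePoint_zero, interp]
  · simp [edgePoint_len, interp, hL]
  · simp [edgePoint_of_mem h, interp]

theorem edgeKernel_vertex_left (v : V) (y : Γ.Point) : Γ.edgeKernel (.vertex v) y = 0 := by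
  cases y <;> rfl

theorem edgeKernel_vertex_right (v : V) (y : Γ.Point) : Γ.edgeKernel y (.vertex v) = 0 := by
  cases y <;> rfl

theorem edgeKernel_comm (x y : Γ.Point) : Γ.edgeKernel x y = Γ.edgeKernel y x := by
  cases x <;> cases y <;> simp only [edgeKernel]
  rename_i e s _ e' t _
  by_cases h : e = e'
  · subst h; simp [min_comm, mul_comm]
  · simp [h, Ne.symm h]

theorem edgeKernel_edgePoint {e e' : E} {s t : ℝ} (hs : s ∈ Icc 0 (Γ.len e))
    (ht : t ∈ Ioo 0 (Γ.len e')) : Γ.edgeKernel (Γ.edgePoint e s) (.interior e' t ht) =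
      if e = e' then min s t - s * t / Γ.len e else 0 := by
  have hL := (Γ.len_pos e).ne'
  rcases edgePoint_cases hs with rfl | rfl | h
  · simp [edgePoint_zero, edgeKernel, ht.1.le]
  · rw [edgePoint_len, edgeKernel_vertex_left]
    split_ifs with h
    · subst h; rw [min_eq_right ht.2.le]; field_simp; ring
    · rfl
  · simp [edgePoint_of_mem h, edgeKernel]

theorem edgeKernel_edgePoint_edgePoint {e : E} {s t : ℝ} (hs : s ∈ Icc 0 (Γ.len e))
    (ht : t ∈ Icc 0 (Γ.len e)) :
    Γ.edgeKernel (Γ.edgePoint e s) (Γ.edgePoint e t) = min s t - s * t / Γ.len e := by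
  have hL := (Γ.len_pos e).ne'
  rcases edgePoint_cases ht with rfl | rfl | h
  · simp [edgePoint_zero, edgeKernel_vertex_right, hs.1]
  · rw [edgePoint_len, edgeKernel_vertex_right, min_eq_left hs.2]; field_simp; ring
  · rw [edgePoint_of_mem h, edgeKernel_edgePoint hs, if_pos rfl]

theorem interp_interp_comm (H : V → V → ℝ) (x y : Γ.Point) :
    Γ.interp (fun u => Γ.interp (H u) y) x = Γ.interp (fun v => Γ.interp (fun u => H u v) x) y := by
  cases x <;> cases y <;> simp only [interp]
  ring

/-- The parameter, on the edge of `d`, of the point `x` from which the direction `d` emanates. -/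
def startParam (Γ : MetrizedGraph V E) : Γ.Point → E × Bool → ℝ
  | .vertex _, d => if d.2 then Γ.len d.1 else 0
  | .interior _ t _, _ => t

/-- The orientation of a direction. -/
def dirSign (d : E × Bool) : ℝ := if d.2 then -1 else 1

theorem startParam_mem {x : Γ.Point} {d : E × Bool} (hd : d ∈ Γ.directions x) :
    Γ.startParam x d ∈ Icc 0 (Γ.len d.1) := by
  cases x with
  | vertex v => simp only [startParam]; split_ifs <;> simp [(Γ.len_pos d.1).le]
  | interior e t ht => obtain rfl : d.1 = e := hd; exact ⟨ht.1.le, ht.2.le⟩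

theorem edgePoint_startParam {x : Γ.Point} {d : E × Bool} (hd : d ∈ Γ.directions x) :
    Γ.edgePoint d.1 (Γ.startParam x d) = x := by
  cases x with
  | vertex v =>
    obtain ⟨e, b⟩ := d
    cases b
    · obtain rfl : Γ.src e = v := hd; simp [startParam, edgePoint_zero]
    · obtain rfl : Γ.tgt e = v := hd; simp [startParam, edgePoint_len]
  | interior e t ht => obtain rfl : d.1 = e := hd; exact edgePoint_of_mem ht

theorem ray_eq (x : Γ.Point) (d : E × Bool) (s : ℝ) :
    Γ.ray x d s = Γ.edgePoint d.1 (Γ.startParam x d + dirSign d * s) := by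
  obtain ⟨e, b⟩ := d
  cases x <;> cases b <;> simp [ray, startParam, dirSign, sub_eq_add_neg]

theorem eventually_startParam_add_mem {x : Γ.Point} {d : E × Bool} (hd : d ∈ Γ.directions x) :
    ∀ᶠ s in 𝓝[>] (0 : ℝ), Γ.startParam x d + dirSign d * s ∈ Icc 0 (Γ.len d.1) := by
  obtain ⟨e, b⟩ := d
  cases x with
  | vertex v =>
    filter_upwards [Ioo_mem_nhdsGT (Γ.len_pos e)] with s hs
    cases b <;> simp only [startParam, dirSign] <;> constructor <;> simp <;>
      linarith [hs.1, hs.2]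
  | interior e' t ht =>
    obtain rfl : e = e' := hd
    filter_upwards [Ioo_mem_nhdsGT ht.1, Ioo_mem_nhdsGT (sub_pos.mpr ht.2)] with s hs hs'
    cases b <;> simp only [startParam, dirSign] <;> constructor <;> simp <;>
      linarith [hs.1, hs.2, hs'.1, hs'.2]

/-- `f` is continuous and piecewise affine along all directions, and `Δ f = ∑ ρ(x) δₓ`. -/
def HasLaplacian (Γ : MetrizedGraph V E) (f ρ : Γ.Point → ℝ) : Prop :=
  ∀ x, ∃ slope : E × Bool → ℝ,
    (∀ d ∈ Γ.directions x, ∀ᶠ s in 𝓝[>] (0 : ℝ), f (Γ.ray x d s) = f x + s * slope d) ∧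
    -(∑ᶠ d ∈ Γ.directions x, slope d) = ρ x

theorem eventually_ray_of_forall {f : Γ.Point → ℝ} {H : ℝ → ℝ} {x : Γ.Point} {d : E × Bool}
    (hd : d ∈ Γ.directions x) (hf : ∀ t ∈ Icc 0 (Γ.len d.1), f (Γ.edgePoint d.1 t) = H t)
    {a : ℝ} (ha : ∀ᶠ s in 𝓝[>] (0 : ℝ), H (Γ.startParam x d + dirSign d * s) =
      H (Γ.startParam x d) + s * a) :
    ∀ᶠ s in 𝓝[>] (0 : ℝ), f (Γ.ray x d s) = f x + s * a := by
  filter_upwards [ha, eventually_startParam_add_mem hd] with s hs hm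
  have hx := hf _ (startParam_mem hd)
  rw [edgePoint_startParam hd] at hx
  rw [ray_eq, hf _ hm, hs, hx]

theorem finsum_directions_interior {e : E} {t : ℝ} (ht : t ∈ Ioo 0 (Γ.len e))
    (f : E × Bool → ℝ) :
    ∑ᶠ d ∈ Γ.directions (.interior e t ht), f d = f (e, false) + f (e, true) := by
  have : Γ.directions (.interior e t ht) = {(e, false), (e, true)} := by
    ext ⟨e', b⟩
    cases b <;> simp [directions]
  rw [this, finsum_mem_pair (by simp)]

variable [Fintype E]

theorem finsum_directions (x : Γ.Point) (f : E × Bool → ℝ) :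
    ∑ᶠ d ∈ Γ.directions x, f d = ∑ d, if d ∈ Γ.directions x then f d else 0 := by
  rw [finsum_mem_def, finsum_eq_sum_of_fintype]
  rfl

theorem finsum_directions_vertex (v : V) (f : E × Bool → ℝ) :
    ∑ᶠ d ∈ Γ.directions (.vertex v), f d =
      ∑ e, (kronecker (Γ.src e) v * f (e, false) + kronecker (Γ.tgt e) v * f (e, true)) := by
  rw [finsum_directions, Fintype.sum_prod_type]
  refine Finset.sum_congr rfl fun e _ => ?_
  simp [directions, kronecker, add_comm]

namespace HasLaplacian

variable {f f' ρ ρ' : Γ.Point → ℝ}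

omit [Fintype E] in
theorem congr_right (h : Γ.HasLaplacian f ρ) (hρ : ∀ x, ρ x = ρ' x) : Γ.HasLaplacian f ρ' := by
  rwa [← funext hρ]

theorem add (h : Γ.HasLaplacian f ρ) (h' : Γ.HasLaplacian f' ρ') :
    Γ.HasLaplacian (fun x => f x + f' x) fun x => ρ x + ρ' x := by
  intro x
  obtain ⟨s, hs, hs'⟩ := h x
  obtain ⟨r, hr, hr'⟩ := h' x
  refine ⟨fun d => s d + r d, fun d hd => ?_, ?_⟩
  · filter_upwards [hs d hd, hr d hd] with u hu hu'
    rw [hu, hu']; ring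
  · change _ = ρ x + ρ' x
    rw [← hs', ← hr', finsum_mem_add_distrib (Set.toFinite _)]; ring

theorem neg (h : Γ.HasLaplacian f ρ) : Γ.HasLaplacian (fun x => -f x) fun x => -ρ x := by
  intro x
  obtain ⟨s, hs, hs'⟩ := h x
  refine ⟨fun d => -s d, fun d hd => ?_, ?_⟩
  · filter_upwards [hs d hd] with u hu
    rw [hu]; ring
  · change _ = -ρ x
    rw [← hs', finsum_mem_neg_distrib _ (Set.toFinite _)]

theorem sub (h : Γ.HasLaplacian f ρ) (h' : Γ.HasLaplacian f' ρ') :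
    Γ.HasLaplacian (fun x => f x - f' x) fun x => ρ x - ρ' x := by
  simpa only [sub_eq_add_neg] using h.add h'.neg

omit [Fintype E] in
theorem const (c : ℝ) : Γ.HasLaplacian (fun _ => c) fun _ => 0 :=
  fun _ => ⟨fun _ => 0, fun _ _ => by simp, by simp⟩

end HasLaplacian

theorem hasLaplacian_interp (φ : V → ℝ) :
    Γ.HasLaplacian (Γ.interp φ) fun
      | .vertex v => Γ.laplacian φ v
      | .interior _ _ _ => 0 := by
  intro x
  refine ⟨fun d => dirSign d * ((φ (Γ.tgt d.1) - φ (Γ.src d.1)) / Γ.len d.1), fun d hd => ?_, ?_⟩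
  · refine eventually_ray_of_forall hd (fun t ht => interp_edgePoint φ ht) (.of_forall fun s => ?_)
    ring
  · cases x with
    | vertex v =>
      change _ = Γ.laplacian φ v
      rw [finsum_directions_vertex, laplacian, ← Finset.sum_neg_distrib]
      refine Finset.sum_congr rfl fun e _ => ?_
      simp [dirSign]
      ring
    | interior e t ht => rw [finsum_directions_interior]; simp [dirSign]

/-- The point mass at y minus its sweeping onto the end points of its edge, with the affine weights.
The interpolated part of `pointGreen` supplies the swept mass. -/
theorem hasLaplacian_edgeKernel (y : Γ.Point) :
    Γ.HasLaplacian (fun x => Γ.edgeKernel x y) fun x =>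
      ({y} : Set Γ.Point).indicator 1 x - match x with
        | .vertex v => Γ.interp (fun u => kronecker u v) y
        | .interior _ _ _ => 0 := by
  cases y with
  | vertex w =>
    convert HasLaplacian.const (Γ := Γ) 0 using 1
    · ext x; rw [edgeKernel_vertex_right]
    · ext x
      cases x <;> simp [interp, kronecker, indicator, eq_comm]
  | interior e₀ t₀ ht₀ =>
    intro x
    have hL := (Γ.len_pos e₀).ne'
    refine ⟨fun d => if d.1 = e₀ then
      (if Γ.startParam x d < t₀ ∨ Γ.startParam x d = t₀ ∧ dirSign d < 0 then dirSign d else 0) -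
        dirSign d * t₀ / Γ.len e₀ else 0, fun d hd => ?_, ?_⟩
    · refine eventually_ray_of_forall (f := fun x => Γ.edgeKernel x _)
        (H := fun t => if d.1 = e₀ then min t t₀ - t * t₀ / Γ.len d.1 else 0) hd
        (fun t ht => edgeKernel_edgePoint ht ht₀) ?_
      filter_upwards [eventually_min_add_mul (Γ.startParam x d) t₀ (dirSign d)] with s hs
      by_cases h1 : d.1 = e₀
      · simp only [h1, if_true, hs]; ring
      · simp only [if_neg h1]; ring
    · cases x with
      | vertex v =>
        rw [finsum_directions_vertex, Finset.sum_eq_single e₀]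
        · simp [startParam, dirSign, ht₀.1, ht₀.2.not_gt, ht₀.2.ne', interp]; ring
        · intro e _ he; simp [he]
        · simp
      | interior e t ht =>
        rw [finsum_directions_interior]
        by_cases he : e = e₀
        · subst he
          rcases lt_trichotomy t t₀ with h | h | h
          · simp [startParam, dirSign, h, h.ne]; ring
          · subst h; norm_num [startParam, dirSign]; ring
          · simp [startParam, dirSign, h.not_gt, h.ne']; ring
        · simp [he]

omit [Fintype E] in
theorem eq_affine_of_hasLaplacian_zero {f : Γ.Point → ℝ} (hf : Γ.HasLaplacian f fun _ => 0)
    (e : E) : ∃ a, ∀ t ∈ Icc 0 (Γ.len e),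
      f (Γ.edgePoint e t) = f (.vertex (Γ.src e)) + t * a := by
  have hray : ∀ x, ∀ d ∈ Γ.directions x, ∃ a, ∀ᶠ s in 𝓝[>] (0 : ℝ),
      f (Γ.edgePoint d.1 (Γ.startParam x d + dirSign d * s)) = f x + s * a := by
    intro x d hd
    obtain ⟨s, hs, -⟩ := hf x
    exact ⟨s d, by simpa only [ray_eq] using hs d hd⟩
  rw [← edgePoint_zero]
  refine eqOn_affine_of_locally_affine (F := fun t => f (Γ.edgePoint e t)) (Γ.len_pos e) ?_ ?_ ?_
  -- At an interior point the two outgoing slopes sum to zero, so a single affine function fits both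
  -- sides.
  · intro t ht
    obtain ⟨s, hs, hsum⟩ := hf (.interior e t ht)
    rw [finsum_directions_interior] at hsum
    have h1 := hs (e, false) rfl
    have h2 := hs (e, true) rfl
    simp only [ray_eq, startParam, dirSign, if_true, Bool.false_eq_true, if_false,
      one_mul] at h1 h2
    rw [← edgePoint_of_mem ht] at h1 h2
    rw [Filter.Eventually, mem_nhdsGT_iff_exists_Ioo_subset] at h1 h2
    obtain ⟨δ, hδ, h1⟩ := h1
    obtain ⟨δ', hδ', h2⟩ := h2
    refine ⟨s (e, false), ?_⟩
    have hδ : 0 < δ := hδ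
    have hδ' : 0 < δ' := hδ'
    filter_upwards [Ioo_mem_nhds (show t - δ' < t by linarith) (show t < t + δ by linarith)]
      with u hu
    rcases lt_trichotomy u t with h | h | h
    · have := h2 (show t - u ∈ Ioo 0 δ' from ⟨by linarith, by linarith [hu.1]⟩)
      simp only [mem_ofPred_eq, show t + -1 * (t - u) = u by ring] at this
      rw [this, show s (e, true) = -s (e, false) by linarith]
      ring
    · simp [h]
    · have := h1 (show u - t ∈ Ioo 0 δ from ⟨by linarith, by linarith [hu.2]⟩)
      simpa only [mem_ofPred_eq, add_sub_cancel] using this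
  · simpa [edgePoint_zero, startParam, dirSign] using hray (.vertex (Γ.src e)) (e, false) rfl
  · simpa [edgePoint_len, startParam, dirSign, sub_eq_add_neg] using
      hray (.vertex (Γ.tgt e)) (e, true) rfl

variable [Fintype V]

/-- Such f is affine on every edge, so its restriction to the vertices is harmonic for the discrete
Laplacian. -/
theorem Connected.eq_of_hasLaplacian_zero (hΓ : Γ.Connected) {f : Γ.Point → ℝ}
    (hf : Γ.HasLaplacian f fun _ => 0) (x y : Γ.Point) : f x = f y := by
  choose a ha using eq_affine_of_hasLaplacian_zero hf
  set φ : V → ℝ := fun v => f (.vertex v) with hφ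
  have hae : ∀ e, a e = (φ (Γ.tgt e) - φ (Γ.src e)) / Γ.len e := by
    intro e
    have h := ha e (Γ.len e) ⟨(Γ.len_pos e).le, le_rfl⟩
    rw [edgePoint_len] at h
    rw [hφ, eq_div_iff (Γ.len_pos e).ne']
    simp only [h]; ring
  have hlap : ∀ v, Γ.laplacian φ v = 0 := by
    intro v
    obtain ⟨s, hs, hsum⟩ := hf (.vertex v)
    have hsd : ∀ d ∈ Γ.directions (.vertex v), s d = dirSign d * a d.1 := by
      intro d hd
      refine (eq_of_eventually_add_mul_eq (a := f (.vertex v)) (c := f (.vertex v)) ?_).2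
      filter_upwards [hs d hd, eventually_ray_of_forall hd (ha d.1)
        (a := dirSign d * a d.1) (.of_forall fun s => by ring)] with s h1 h2
      rw [← h1, h2]
    rw [finsum_mem_congr rfl hsd, finsum_directions_vertex] at hsum
    rw [← show _ = (0 : ℝ) from hsum, laplacian, ← Finset.sum_neg_distrib]
    refine Finset.sum_congr rfl fun e _ => ?_
    simp [dirSign, hae]
    ring
  have hc := hΓ.eq_of_laplacian_eq_zero hlap
  have hx : ∀ x v, f x = φ v := by
    intro x v
    cases x with
    | vertex w => exact hc w v
    | interior e t ht =>
      rw [← edgePoint_of_mem ht, ha e t ⟨ht.1.le, ht.2.le⟩, hae, hc (Γ.tgt e) (Γ.src e)]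
      simpa using hc _ v
  obtain ⟨v⟩ := hΓ.nonempty
  rw [hx x v, hx y v]

omit [Fintype V] in
theorem IsGreen.hasLaplacian (hG : Γ.IsGreen p G) (y : Γ.Point) :
    Γ.HasLaplacian (fun x => Γ.pointGreen G x y) fun x =>
      ({y} : Set Γ.Point).indicator 1 x - ({.vertex p} : Set Γ.Point).indicator 1 x := by
  have h := (hasLaplacian_interp fun u => Γ.interp (G u) y).add (hasLaplacian_edgeKernel y)
  refine HasLaplacian.congr_right h fun x => ?_
  cases x with
  | interior e t ht => simp [indicator_apply]
  | vertex v =>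
    have : Γ.laplacian (fun u => Γ.interp (G u) y) v =
        Γ.interp (fun u => kronecker u v) y - kronecker v p := by
      cases y with
      | vertex w => simp only [interp]; rw [hG.lap, kronecker_comm]
      | interior e t ht =>
        simp only [interp]
        rw [laplacian_add, laplacian_const_mul, laplacian_sub, hG.lap, hG.lap,
          kronecker_comm v (Γ.src e), kronecker_comm v (Γ.tgt e)]
        ring
    simp only [this, indicator_apply, kronecker, mem_singleton_iff, Point.vertex.injEq]
    simp

/-- The right side is a voltage, so the function picked by `epsilon` is one too; their difference
has zero Laplacian and vanishes at z. -/
theorem IsGreen.voltage_eq (hG : Γ.IsGreen p G) (hΓ : Γ.Connected) (z x y : Γ.Point) :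
    Γ.voltage z x y = Γ.pointGreen G x y - Γ.pointGreen G x z -
      (Γ.pointGreen G z y - Γ.pointGreen G z z) := by
  set f : Γ.Point → ℝ := fun x => Γ.pointGreen G x y - Γ.pointGreen G x z -
      (Γ.pointGreen G z y - Γ.pointGreen G z z) with hf
  have h1 : Γ.IsVoltage z y f := by
    refine ⟨by simp [hf], ?_⟩
    have h := ((hG.hasLaplacian y).sub (hG.hasLaplacian z)).sub
      (HasLaplacian.const (Γ.pointGreen G z y - Γ.pointGreen G z z))
    exact h.congr_right fun x => by ring
  have h2 : Γ.IsVoltage z y (Classical.epsilon (Γ.IsVoltage z y)) := Classical.epsilon_spec ⟨f, h1⟩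
  have h3 := HasLaplacian.sub (Γ := Γ) h2.2 h1.2
  simp only [sub_self] at h3
  have := hΓ.eq_of_hasLaplacian_zero h3 x z
  rw [h1.1, h2.1, sub_self, sub_eq_zero] at this
  exact this

end MetrizedGraph
end

/-! ### Integration against signed measures, and continuity on Γ. -/

noncomputable section

theorem integral_signedMeasure_eq_sub {X : Type*} [MeasurableSpace X] (μ : SignedMeasure X)
    {f : X → ℝ} (hp : Integrable f μ.toJordanDecomposition.posPart)
    (hn : Integrable f μ.toJordanDecomposition.negPart) :
    ∫ᵛ x, f x ∂•μ = ∫ x, f x ∂μ.toJordanDecomposition.posPart -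
      ∫ x, f x ∂μ.toJordanDecomposition.negPart := by
  -- Multiplication on ℝ is commutative; the flipped pairing is the form to which
  -- `VectorMeasure.integral_toSignedMeasure` applies.
  have hflip : ContinuousLinearMap.lsmul ℝ ℝ (E := ℝ) =
      (ContinuousLinearMap.lsmul ℝ ℝ (E := ℝ)).flip := by ext; simp
  conv_lhs => rw [← μ.toSignedMeasure_toJordanDecomposition, JordanDecomposition.toSignedMeasure]
  rw [VectorMeasure.integral_sub_vectorMeasure, hflip, VectorMeasure.integral_toSignedMeasure,
    VectorMeasure.integral_toSignedMeasure] <;>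
  simpa [VectorMeasure.Integrable]

theorem isFiniteMeasure_variation_signedMeasure {X : Type*} [MeasurableSpace X]
    (μ : SignedMeasure X) : IsFiniteMeasure μ.variation := by
  rw [← SignedMeasure.totalVariation_eq_variation, SignedMeasure.totalVariation]
  infer_instance

/-- A Carathéodory function, measurable in x and continuous in t, is jointly measurable; no topology
on X is needed. -/
theorem integrable_uncurry_of_continuous_right {X : Type*} [MeasurableSpace X]
    {H : X → ℝ → ℝ} (hx : ∀ t, Measurable fun x => H x t) (ht : ∀ x, Continuous (H x)) {C : ℝ}
    (hC : ∀ x t, |H x t| ≤ C) (ν : Measure X) [IsFiniteMeasure ν] (L : ℝ) :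
    Integrable (Function.uncurry H) (ν.prod (volume.restrict (Ioc 0 L))) := by
  have hm : StronglyMeasurable (Function.uncurry fun x t => H x t) :=
    (measurable_uncurry_of_continuous_of_measurable (u := fun t x => H x t) ht hx).comp
      measurable_swap |>.stronglyMeasurable
  exact Integrable.of_bound hm.aestronglyMeasurable C (.of_forall fun z => hC z.1 z.2)

/-- Fubini's theorem for a signed measure and Lebesgue measure on a segment. -/
theorem integral_signedMeasure_intervalIntegral_comm {X : Type*} [MeasurableSpace X]
    (μ : SignedMeasure X) {H : X → ℝ → ℝ} (hx : ∀ t, Measurable fun x => H x t)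
    (ht : ∀ x, Continuous (H x)) {C : ℝ} (hC : ∀ x t, |H x t| ≤ C) {L : ℝ} (hL : 0 ≤ L) :
    ∫ᵛ x, (∫ t in 0..L, H x t) ∂•μ = ∫ t in 0..L, ∫ᵛ x, H x t ∂•μ := by
  have hint : ∀ (ν : Measure X) [IsFiniteMeasure ν],
      Integrable (Function.uncurry H) (ν.prod (volume.restrict (Ioc 0 L))) := fun ν _ =>
    integrable_uncurry_of_continuous_right hx ht hC ν L
  have hint2 : ∀ (ν : Measure X) [IsFiniteMeasure ν] (t : ℝ), Integrable (fun x => H x t) ν :=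
    fun ν _ t => Integrable.of_bound (hx t).aestronglyMeasurable C (.of_forall fun x => hC x t)
  simp only [intervalIntegral.integral_of_le hL]
  have hleft : ∀ (ν : Measure X) [IsFiniteMeasure ν],
      Integrable (fun x => ∫ t in Ioc 0 L, H x t) ν := fun ν _ => (hint ν).integral_prod_left
  have hright : ∀ (ν : Measure X) [IsFiniteMeasure ν],
      Integrable (fun t => ∫ x, H x t ∂ν) (volume.restrict (Ioc 0 L)) :=
    fun ν _ => (hint ν).integral_prod_right
  rw [integral_signedMeasure_eq_sub _ (hleft _) (hleft _), integral_integral_swap (hint _),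
    integral_integral_swap (hint _), ← integral_sub (hright _) (hright _)]
  congr 1
  ext t
  rw [integral_signedMeasure_eq_sub _ (hint2 _ t) (hint2 _ t)]

namespace MetrizedGraph

open scoped Classical

variable {V E : Type*} {Γ : MetrizedGraph V E} {p : V} {G : V → V → ℝ}

/-- `edgePoint` is constant beyond either end of the segment, so continuity on the segment gives
continuity on ℝ. -/
theorem edgePoint_projIcc (e : E) (t : ℝ) :
    Γ.edgePoint e (projIcc 0 (Γ.len e) (Γ.len_pos e).le t) = Γ.edgePoint e t := by
  have hL := Γ.len_pos e
  rcases le_or_gt t 0 with h | h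
  · rw [projIcc_of_le_left _ h]; simp [edgePoint, h]
  · rcases le_or_gt (Γ.len e) t with h' | h'
    · rw [projIcc_of_right_le _ h']; simp [edgePoint, h.not_ge, h', hL]
    · rw [projIcc_of_mem _ ⟨h.le, h'.le⟩]

theorem continuous_edgePoint (e : E) : Continuous (Γ.edgePoint e) := by
  have h : Continuous fun t : Icc (0 : ℝ) (Γ.len e) => Γ.edgePoint e t :=
    continuous_iff_coinduced_le.mpr
      (le_iSup (fun e => TopologicalSpace.coinduced
        (fun t : Icc (0 : ℝ) (Γ.len e) => Γ.edgePoint e t) inferInstance) e)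
  exact (h.comp (continuous_projIcc (h := (Γ.len_pos e).le))).congr fun t => edgePoint_projIcc e t

theorem continuous_of_forall_edge {f : Γ.Point → ℝ} {H : E → ℝ → ℝ} (hH : ∀ e, Continuous (H e))
    (h : ∀ e, ∀ t ∈ Icc 0 (Γ.len e), f (Γ.edgePoint e t) = H e t) : Continuous f := by
  refine continuous_iSup_dom.mpr fun e => continuous_coinduced_dom.mpr ?_
  exact ((hH e).comp continuous_subtype_val).congr fun t => (h e t t.2).symm

theorem continuous_interp (φ : V → ℝ) : Continuous (Γ.interp φ) :=
  continuous_of_forall_edge (fun e => by fun_prop) fun e t ht => interp_edgePoint φ ht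

theorem continuous_edgeKernel (y : Γ.Point) : Continuous fun x => Γ.edgeKernel x y := by
  cases y with
  | vertex v => simpa only [edgeKernel_vertex_right] using continuous_const
  | interior e₀ t₀ ht₀ =>
    refine continuous_of_forall_edge (H := fun e t =>
      if e = e₀ then min t t₀ - t * t₀ / Γ.len e else 0) (fun e => ?_)
      fun e t ht => edgeKernel_edgePoint ht ht₀
    by_cases he : e = e₀ <;> simp only [he, if_true, if_false] <;> fun_prop

theorem abs_interp_le {φ : V → ℝ} {C : ℝ} (h : ∀ v, |φ v| ≤ C) (x : Γ.Point) :
    |Γ.interp φ x| ≤ C := by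
  cases x with
  | vertex v => exact h v
  | interior e t ht =>
    have hL := Γ.len_pos e
    have h0 : 0 ≤ t / Γ.len e := div_nonneg ht.1.le hL.le
    have h1 : t / Γ.len e ≤ 1 := (div_le_one hL).mpr ht.2.le
    simp only [interp]
    have ha := abs_le.mp (h (Γ.src e))
    have hb := abs_le.mp (h (Γ.tgt e))
    rw [abs_le]
    constructor <;> nlinarith

theorem abs_edgeKernel_le [Fintype E] (x y : Γ.Point) : |Γ.edgeKernel x y| ≤ Γ.totalLength := by
  have hnn : 0 ≤ Γ.totalLength := Finset.sum_nonneg fun e _ => (Γ.len_pos e).le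
  cases x with
  | vertex v => simpa [edgeKernel_vertex_left]
  | interior e s hs =>
    cases y with
    | vertex v => simpa [edgeKernel_vertex_right]
    | interior e' t ht =>
      simp only [edgeKernel]
      split_ifs with h
      · subst h
        have hL := Γ.len_pos e
        have hle : Γ.len e ≤ Γ.totalLength :=
          Finset.single_le_sum (f := Γ.len) (fun e _ => (Γ.len_pos e).le) (Finset.mem_univ e)
        have h1 : s * t / Γ.len e ≤ min s t := by
          refine le_min ?_ ?_ <;> rw [div_le_iff₀ hL]
          · exact mul_le_mul_of_nonneg_left ht.2.le hs.1.le
          · rw [mul_comm]; exact mul_le_mul_of_nonneg_left hs.2.le ht.1.le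
        have h2 : 0 ≤ s * t / Γ.len e := div_nonneg (mul_nonneg hs.1.le ht.1.le) hL.le
        rw [abs_of_nonneg (by linarith)]
        linarith [min_le_left s t, hs.2]
      · simpa

theorem continuous_pointGreen_left (y : Γ.Point) :
    Continuous fun x => Γ.pointGreen G x y :=
  (continuous_interp _).add (continuous_edgeKernel y)

theorem pointGreen_vertex_right (x : Γ.Point) (v : V) :
    Γ.pointGreen G x (.vertex v) = Γ.interp (fun u => G u v) x := by
  simp [pointGreen, edgeKernel_vertex_right, interp]

namespace IsGreen

variable [Fintype E]

theorem pointGreen_comm (hG : Γ.IsGreen p G) (x y : Γ.Point) :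
    Γ.pointGreen G x y = Γ.pointGreen G y x := by
  rw [pointGreen, pointGreen, interp_interp_comm, edgeKernel_comm]
  simp only [hG.symm]

theorem pointGreen_base (hG : Γ.IsGreen p G) (y : Γ.Point) :
    Γ.pointGreen G (.vertex p) y = 0 := by
  rw [pointGreen, edgeKernel_vertex_left, add_zero]
  cases y <;> simp [interp, hG.base]

/-- On the diagonal, bilinear interpolation falls short of affine interpolation by t(L - t)/L² times
the gap, while the Dirichlet kernel adds t(L - t)/L. -/
theorem pointGreen_diag (hG : Γ.IsGreen p G) {e : E} {t : ℝ} (ht : t ∈ Icc 0 (Γ.len e)) :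
    Γ.pointGreen G (Γ.edgePoint e t) (Γ.edgePoint e t) =
      Γ.interp (fun u => G u u) (Γ.edgePoint e t) +
        t * (Γ.len e - t) / Γ.len e ^ 2 * (Γ.len e - Γ.edgeGap G e) := by
  have hL := (Γ.len_pos e).ne'
  rw [pointGreen, edgeKernel_edgePoint_edgePoint ht ht, interp_edgePoint _ ht,
    interp_edgePoint _ ht, interp_edgePoint _ ht, interp_edgePoint _ ht, min_self,
    hG.symm (Γ.tgt e) (Γ.src e), edgeGap]
  field_simp
  ring

theorem continuous_pointGreen_diag (hG : Γ.IsGreen p G) :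
    Continuous fun x => Γ.pointGreen G x x :=
  continuous_of_forall_edge (H := fun e t => (G (Γ.src e) (Γ.src e) +
    t / Γ.len e * (G (Γ.tgt e) (Γ.tgt e) - G (Γ.src e) (Γ.src e))) +
    t * (Γ.len e - t) / Γ.len e ^ 2 * (Γ.len e - Γ.edgeGap G e)) (fun e => by fun_prop)
    fun e t ht => by rw [hG.pointGreen_diag ht, interp_edgePoint _ ht]

theorem resistance_eq (hG : Γ.IsGreen p G) [Fintype V] (hΓ : Γ.Connected) (x y : Γ.Point) :
    Γ.resistance x y =
      Γ.pointGreen G x x - 2 * Γ.pointGreen G x y + Γ.pointGreen G y y := by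
  rw [resistance, hG.voltage_eq hΓ, hG.pointGreen_comm y x]
  ring

end IsGreen

end MetrizedGraph
end

/-! ### The canonical measure and the tau constant. -/

noncomputable section

theorem integral_min_const {s L : ℝ} (hs : 0 ≤ s) (hL : s ≤ L) :
    ∫ t in 0..L, min s t = s * L - s ^ 2 / 2 := by
  have hi : ∀ a b : ℝ, IntervalIntegrable (fun t => min s t) volume a b := fun a b =>
    Continuous.intervalIntegrable (by fun_prop) a b
  rw [← intervalIntegral.integral_add_adjacent_intervals (hi 0 s) (hi s L)]
  have h1 : ∫ t in 0..s, min s t = ∫ t in 0..s, t :=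
    intervalIntegral.integral_congr fun t ht => by
      rw [uIcc_of_le hs] at ht; exact min_eq_right ht.2
  have h2 : ∫ t in s..L, min s t = ∫ _t in s..L, s :=
    intervalIntegral.integral_congr fun t ht => by
      rw [uIcc_of_le hL] at ht; exact min_eq_left ht.1
  rw [h1, h2, integral_id, intervalIntegral.integral_const, smul_eq_mul]
  ring

theorem integral_min_sub_mul_div {s L : ℝ} (hs : s ∈ Icc 0 L) (hL : L ≠ 0) :
    ∫ t in 0..L, (min s t - s * t / L) = s * (L - s) / 2 := by
  rw [intervalIntegral.integral_sub (Continuous.intervalIntegrable (by fun_prop) _ _)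
    (Continuous.intervalIntegrable (by fun_prop) _ _), integral_min_const hs.1 hs.2]
  simp only [mul_div_assoc, intervalIntegral.integral_const_mul, intervalIntegral.integral_div,
    integral_id]
  field_simp
  ring

theorem integral_quadratic (a b c L : ℝ) :
    ∫ t in 0..L, (a + (b * t - c * t ^ 2)) = a * L + b * L ^ 2 / 2 - c * L ^ 3 / 3 := by
  have h1 : ∫ t in 0..L, b * t = b * (L ^ 2 / 2) := by
    rw [intervalIntegral.integral_const_mul, integral_id]; ring
  have h2 : ∫ t in 0..L, c * t ^ 2 = c * (L ^ 3 / 3) := by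
    rw [intervalIntegral.integral_const_mul, integral_pow]; norm_num
  rw [intervalIntegral.integral_add (Continuous.intervalIntegrable (by fun_prop) _ _)
    (Continuous.intervalIntegrable (by fun_prop) _ _), intervalIntegral.integral_sub
    (Continuous.intervalIntegrable (by fun_prop) _ _)
    (Continuous.intervalIntegrable (by fun_prop) _ _), h1, h2, intervalIntegral.integral_const,
    smul_eq_mul]
  ring

namespace MetrizedGraph

open scoped Classical

variable {V E : Type*} [Fintype V] [Fintype E] {Γ : MetrizedGraph V E} {p : V} {G : V → V → ℝ}

omit [Fintype V] in
theorem cast_valence_vertex (v : V) : (Γ.valence (.vertex v) : ℝ) = Γ.degree v := by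
  have h := Γ.finsum_directions_vertex v fun _ => 1
  rw [finsum_directions] at h
  simp only [mul_one] at h
  rw [degree, ← h, valence, Set.ncard_eq_toFinset_card']
  simp

theorem compactSpace_point : CompactSpace Γ.Point := by
  -- The vertices are listed separately because, without connectedness, a vertex may lie on no edge.
  have h : (univ : Set Γ.Point) =
      range (Point.vertex (Γ := Γ)) ∪ ⋃ e, Γ.edgePoint e '' Icc 0 (Γ.len e) := by
    refine (eq_univ_of_forall fun x => ?_).symm
    cases x with
    | vertex v => exact Or.inl ⟨v, rfl⟩
    | interior e t ht =>
      exact Or.inr (mem_iUnion.mpr ⟨e, t, ⟨ht.1.le, ht.2.le⟩, edgePoint_of_mem ht⟩)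
  refine ⟨h ▸ (finite_range _).isCompact.union (isCompact_iUnion fun e => ?_)⟩
  exact isCompact_Icc.image (continuous_edgePoint e)

theorem integrable_of_continuous {f : Γ.Point → ℝ} (hf : Continuous f) (ν : Measure Γ.Point)
    [IsFiniteMeasure ν] : Integrable f ν := by
  have := Γ.compactSpace_point
  exact hf.integrable_of_hasCompactSupport (HasCompactSupport.of_compactSpace f)

/-- The canonical measure: point masses `1 - υ(v) / 2` at the vertices, and the density
`(1 - r(e) / L) / L = 1 / (L + R)` on every edge. -/
def explicitCanonicalMeasure (Γ : MetrizedGraph V E) (G : V → V → ℝ) : SignedMeasure Γ.Point :=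
  ∑ v, VectorMeasure.dirac (.vertex v) (1 - Γ.degree v / 2) +
    ∑ e, ((1 - Γ.edgeGap G e / Γ.len e) / Γ.len e) •
      ((volume.restrict (Ioc 0 (Γ.len e))).map (Γ.edgePoint e)).toSignedMeasure

theorem integral_explicitCanonicalMeasure {f : Γ.Point → ℝ} (hf : Continuous f) :
    ∫ᵛ x, f x ∂•(Γ.explicitCanonicalMeasure G) =
      ∑ v, (1 - Γ.degree v / 2) * f (.vertex v) +
        ∑ e, (1 - Γ.edgeGap G e / Γ.len e) / Γ.len e *
          ∫ t in 0..Γ.len e, f (Γ.edgePoint e t) := by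
  have hflip : ContinuousLinearMap.lsmul ℝ ℝ (E := ℝ) =
      (ContinuousLinearMap.lsmul ℝ ℝ (E := ℝ)).flip := by ext; simp
  have hint : ∀ μ : SignedMeasure Γ.Point, μ.Integrable f := fun μ =>
    have := isFiniteMeasure_variation_signedMeasure μ
    Γ.integrable_of_continuous hf _
  rw [explicitCanonicalMeasure, VectorMeasure.integral_add_vectorMeasure (hint _) (hint _),
    VectorMeasure.integral_finsetSum_vectorMeasure fun _ _ => hint _,
    VectorMeasure.integral_finsetSum_vectorMeasure fun _ _ => hint _]
  congr 1
  · refine Finset.sum_congr rfl fun v _ => ?_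
    rw [VectorMeasure.integral_dirac' hf.stronglyMeasurable]
    simp [mul_comm]
  · refine Finset.sum_congr rfl fun e _ => ?_
    rw [VectorMeasure.integral_smul_vectorMeasure, hflip, VectorMeasure.integral_toSignedMeasure,
      integral_map (continuous_edgePoint e).measurable.aemeasurable
        hf.stronglyMeasurable.aestronglyMeasurable,
      intervalIntegral.integral_of_le (Γ.len_pos e).le, smul_eq_mul]

omit [Fintype V] [Fintype E] in
theorem integral_const_signedMeasure (μ : SignedMeasure Γ.Point) (c : ℝ) :
    ∫ᵛ _x, c ∂•μ = c * μ univ := by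
  have := isFiniteMeasure_variation_signedMeasure μ
  simp

theorem explicitCanonicalMeasure_univ :
    Γ.explicitCanonicalMeasure G univ =
      ∑ v, (1 - Γ.degree v / 2) + ∑ e, (1 - Γ.edgeGap G e / Γ.len e) := by
  have h := Γ.integral_explicitCanonicalMeasure (G := G) (f := fun _ => 1) continuous_const
  rw [integral_const_signedMeasure, one_mul] at h
  rw [h]
  congr 1
  · simp
  · refine Finset.sum_congr rfl fun e _ => ?_
    have := (Γ.len_pos e).ne'
    simp
    field_simp

omit [Fintype V] [Fintype E] in
theorem measureVoltage_self (μ : SignedMeasure Γ.Point) (x : Γ.Point) :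
    Γ.measureVoltage μ x x = ∫ᵛ ζ, Γ.resistance x ζ ∂•μ := rfl

omit [Fintype V] [Fintype E] in
theorem interp_add (φ ψ : V → ℝ) (x : Γ.Point) :
    Γ.interp (fun u => φ u + ψ u) x = Γ.interp φ x + Γ.interp ψ x := by
  cases x with
  | vertex v => rfl
  | interior e t ht => simp only [interp]; ring

omit [Fintype V] [Fintype E] in
theorem interp_const_mul (c : ℝ) (φ : V → ℝ) (x : Γ.Point) :
    Γ.interp (fun u => c * φ u) x = c * Γ.interp φ x := by
  cases x with
  | vertex v => rfl
  | interior e t ht => simp only [interp]; ring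

omit [Fintype V] [Fintype E] in
theorem interp_sum {ι : Type*} (s : Finset ι) (φ : ι → V → ℝ)
    (x : Γ.Point) : Γ.interp (fun u => ∑ i ∈ s, φ i u) x = ∑ i ∈ s, Γ.interp (φ i) x := by
  cases x with
  | vertex v => rfl
  | interior e t ht =>
    simp only [interp, Finset.sum_add_distrib, ← Finset.mul_sum, Finset.sum_sub_distrib]

omit [Fintype V] [Fintype E] in
theorem integral_edgeKernel {e e₀ : E} {s : ℝ}
    (hs : s ∈ Ioo 0 (Γ.len e₀)) :
    ∫ t in 0..Γ.len e, Γ.edgeKernel (.interior e₀ s hs) (Γ.edgePoint e t) =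
      if e = e₀ then s * (Γ.len e₀ - s) / 2 else 0 := by
  have hL := Γ.len_pos e
  have h : ∫ t in 0..Γ.len e, Γ.edgeKernel (.interior e₀ s hs) (Γ.edgePoint e t) =
      ∫ t in 0..Γ.len e, if e = e₀ then min s t - s * t / Γ.len e else 0 :=
    intervalIntegral.integral_congr fun t ht => by
      rw [uIcc_of_le hL.le] at ht
      rw [edgeKernel_comm, edgeKernel_edgePoint ht, min_comm, mul_comm]
  rw [h]
  by_cases he : e = e₀
  · subst he
    simp only [if_true]
    exact integral_min_sub_mul_div ⟨hs.1.le, hs.2.le⟩ hL.ne'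
  · simp [he]

omit [Fintype V] [Fintype E] in
/-- The integral of the Green function over an edge. -/
theorem integral_pointGreen (e : E) (x : Γ.Point) :
    ∫ t in 0..Γ.len e, Γ.pointGreen G x (Γ.edgePoint e t) =
      Γ.len e / 2 * Γ.interp (fun u => G u (Γ.src e) + G u (Γ.tgt e)) x +
        ∫ t in 0..Γ.len e, Γ.edgeKernel x (Γ.edgePoint e t) := by
  have hL := Γ.len_pos e
  have hk : Continuous fun t => Γ.edgeKernel x (Γ.edgePoint e t) := by
    simp only [edgeKernel_comm x]
    exact (continuous_edgeKernel x).comp (continuous_edgePoint e)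
  have h : ∫ t in 0..Γ.len e, Γ.pointGreen G x (Γ.edgePoint e t) = ∫ t in 0..Γ.len e,
      (Γ.interp (fun u => G u (Γ.src e)) x + t / Γ.len e * (Γ.interp (fun u => G u (Γ.tgt e)) x -
        Γ.interp (fun u => G u (Γ.src e)) x) + Γ.edgeKernel x (Γ.edgePoint e t)) :=
    intervalIntegral.integral_congr fun t ht => by
      rw [uIcc_of_le hL.le] at ht
      simp only [pointGreen]
      rw [interp_interp_comm, interp_edgePoint _ ht]
  rw [h, intervalIntegral.integral_add (Continuous.intervalIntegrable (by fun_prop) _ _)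
    (hk.intervalIntegrable _ _), intervalIntegral.integral_add
    (Continuous.intervalIntegrable (by fun_prop) _ _)
    (Continuous.intervalIntegrable (by fun_prop) _ _), interp_add]
  simp only [intervalIntegral.integral_mul_const, intervalIntegral.integral_div, integral_id,
    intervalIntegral.integral_const, smul_eq_mul]
  congr 1
  field_simp
  ring

namespace IsGreen

/-- The vertices carry |V| - |E| and, by Foster's theorem, the edges carry |E| - |V| + 1. -/
theorem explicitCanonicalMeasure_univ (hG : Γ.IsGreen p G) :
    Γ.explicitCanonicalMeasure G univ = 1 := by
  have hd := Γ.sum_degree_mul fun _ => (1 : ℝ)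
  rw [MetrizedGraph.explicitCanonicalMeasure_univ, Finset.sum_sub_distrib, Finset.sum_sub_distrib,
    hG.sum_edgeGap_div, ← Finset.sum_div]
  simp only [mul_one, Finset.sum_add_distrib] at hd
  rw [hd]
  ring

theorem continuous_resistance (hG : Γ.IsGreen p G) (hΓ : Γ.Connected) (x : Γ.Point) :
    Continuous fun y => Γ.resistance y x := by
  simp only [hG.resistance_eq hΓ]
  exact (hG.continuous_pointGreen_diag.sub
    (continuous_const.mul (continuous_pointGreen_left x))).add continuous_const

theorem resistance_comm (hG : Γ.IsGreen p G) (hΓ : Γ.Connected) (x y : Γ.Point) :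
    Γ.resistance x y = Γ.resistance y x := by
  rw [hG.resistance_eq hΓ, hG.resistance_eq hΓ, hG.pointGreen_comm x y]
  ring

theorem exists_resistance_le (hG : Γ.IsGreen p G) (hΓ : Γ.Connected) :
    ∃ C, ∀ x y, |Γ.resistance x y| ≤ C := by
  have hfin : ∀ u v, |G u v| ≤ ∑ u, ∑ v, |G u v| := fun u v =>
    (Finset.single_le_sum (f := fun v => |G u v|) (fun _ _ => abs_nonneg _)
      (Finset.mem_univ v)).trans
    (Finset.single_le_sum (f := fun u => ∑ v, |G u v|)
      (fun _ _ => Finset.sum_nonneg fun _ _ => abs_nonneg _) (Finset.mem_univ u))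
  have hg : ∀ x y, |Γ.pointGreen G x y| ≤ ∑ u, ∑ v, |G u v| + Γ.totalLength := fun x y =>
    (abs_add_le _ _).trans (add_le_add
      (abs_interp_le (fun u => abs_interp_le (hfin u) y) x) (abs_edgeKernel_le x y))
  refine ⟨4 * (∑ u, ∑ v, |G u v| + Γ.totalLength), fun x y => ?_⟩
  rw [hG.resistance_eq hΓ, abs_le]
  have h1 := abs_le.mp (hg x x)
  have h2 := abs_le.mp (hg x y)
  have h3 := abs_le.mp (hg y y)
  constructor <;> linarith

/-- `g(x, x) = 2 ∫ g(x, ζ) dμ(ζ)` for the canonical measure `μ`. -/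
theorem integral_pointGreen_canonical (hG : Γ.IsGreen p G) (hΓ : Γ.Connected) (x : Γ.Point) :
    2 * ∫ᵛ ζ, Γ.pointGreen G x ζ ∂•(Γ.explicitCanonicalMeasure G) = Γ.pointGreen G x x := by
  have hc : Continuous fun ζ => Γ.pointGreen G x ζ := by
    simp only [hG.pointGreen_comm x]
    exact continuous_pointGreen_left x
  -- The identity at the vertices extends to x by interpolation; only the kernel terms remain to be
  -- compared with the quadratic term of `pointGreen_diag`.
  have hdiag := congrArg (Γ.interp · x) (funext (hG.diag_eq hΓ))
  simp only [interp_add, interp_const_mul, interp_sum] at hdiag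
  have hvert : 2 * ∫ᵛ ζ, Γ.pointGreen G x ζ ∂•(Γ.explicitCanonicalMeasure G) =
      Γ.interp (fun u => G u u) x + 2 * ∑ e, (1 - Γ.edgeGap G e / Γ.len e) / Γ.len e *
        ∫ t in 0..Γ.len e, Γ.edgeKernel x (Γ.edgePoint e t) := by
    rw [integral_explicitCanonicalMeasure hc, hdiag]
    simp only [integral_pointGreen, pointGreen_vertex_right, interp_add]
    rw [mul_add, add_assoc, add_right_inj, Finset.mul_sum, Finset.mul_sum,
      ← Finset.sum_add_distrib]
    refine Finset.sum_congr rfl fun e _ => ?_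
    have hL := (Γ.len_pos e).ne'
    field_simp
  rw [hvert]
  cases x with
  | vertex w => simp [edgeKernel_vertex_left, pointGreen, interp]
  | interior e₀ s hs =>
    have hd := hG.pointGreen_diag (e := e₀) ⟨hs.1.le, hs.2.le⟩
    rw [edgePoint_of_mem hs] at hd
    rw [hd]
    simp only [integral_edgeKernel, mul_ite, mul_zero, Finset.sum_ite_eq', Finset.mem_univ,
      if_true]
    have hL := (Γ.len_pos e₀).ne'
    field_simp

theorem measureVoltage_explicitCanonicalMeasure (hG : Γ.IsGreen p G) (hΓ : Γ.Connected)
    (x : Γ.Point) : Γ.measureVoltage (Γ.explicitCanonicalMeasure G) x x =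
      ∫ᵛ ζ, Γ.pointGreen G ζ ζ ∂•(Γ.explicitCanonicalMeasure G) := by
  have hint : ∀ {f : Γ.Point → ℝ}, Continuous f →
      (Γ.explicitCanonicalMeasure G).Integrable f := fun hf =>
    have := isFiniteMeasure_variation_signedMeasure (Γ.explicitCanonicalMeasure G)
    Γ.integrable_of_continuous hf _
  have hc : Continuous fun ζ => 2 * Γ.pointGreen G x ζ := by
    simp only [hG.pointGreen_comm x]
    exact continuous_const.mul (continuous_pointGreen_left x)
  rw [measureVoltage_self]
  simp only [hG.resistance_eq hΓ]
  rw [VectorMeasure.integral_fun_add (f := fun ζ => Γ.pointGreen G x x - 2 * Γ.pointGreen G x ζ)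
      (hint (continuous_const.sub hc)) (hint hG.continuous_pointGreen_diag),
    VectorMeasure.integral_fun_sub (hint continuous_const) (hint hc), integral_const_signedMeasure,
    hG.explicitCanonicalMeasure_univ]
  have := VectorMeasure.integral_fun_smul (Γ.explicitCanonicalMeasure G)
    (ContinuousLinearMap.lsmul ℝ ℝ) 2 fun ζ => Γ.pointGreen G x ζ
  simp only [smul_eq_mul] at this
  rw [this, hG.integral_pointGreen_canonical hΓ]
  ring

theorem isCanonicalMeasure (hG : Γ.IsGreen p G) (hΓ : Γ.Connected) :
    Γ.IsCanonicalMeasure (Γ.explicitCanonicalMeasure G) :=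
  ⟨hG.explicitCanonicalMeasure_univ, _, hG.measureVoltage_explicitCanonicalMeasure hΓ⟩

/-- All canonical measures have the same constant. -/
theorem measureVoltage_eq (hG : Γ.IsGreen p G) (hΓ : Γ.Connected) {μ : SignedMeasure Γ.Point}
    (hμ : Γ.IsCanonicalMeasure μ) (x : Γ.Point) :
    Γ.measureVoltage μ x x = ∫ᵛ ζ, Γ.pointGreen G ζ ζ ∂•(Γ.explicitCanonicalMeasure G) := by
  obtain ⟨hμ1, c, hc⟩ := hμ
  have hfin := isFiniteMeasure_variation_signedMeasure μ
  obtain ⟨C, hC⟩ := hG.exists_resistance_le hΓ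
  have hr := hG.continuous_resistance hΓ
  have hr' : ∀ x, Continuous fun ζ => Γ.resistance x ζ := fun x => by
    simpa only [hG.resistance_comm hΓ x] using hr x
  set D := ∫ᵛ ζ, Γ.pointGreen G ζ ζ ∂•(Γ.explicitCanonicalMeasure G) with hD
  have hμr : ∀ y, ∫ᵛ x, Γ.resistance x y ∂•μ = c := fun y => by
    rw [← hc y, measureVoltage_self]
    simp only [hG.resistance_comm hΓ y]
  have hexp : ∀ x, D = ∑ v, (1 - Γ.degree v / 2) * Γ.resistance x (.vertex v) +
        ∑ e, (1 - Γ.edgeGap G e / Γ.len e) / Γ.len e *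
          ∫ t in 0..Γ.len e, Γ.resistance x (Γ.edgePoint e t) := fun x => by
    rw [hD, ← hG.measureVoltage_explicitCanonicalMeasure hΓ x, measureVoltage_self,
      integral_explicitCanonicalMeasure (hr' x)]
  have hvint : ∀ v a, μ.Integrable fun x => a * Γ.resistance x (.vertex v) := fun v a =>
    Γ.integrable_of_continuous (continuous_const.mul (hr _)) _
  have heint : ∀ e a, μ.Integrable fun x =>
      a * ∫ t in 0..Γ.len e, Γ.resistance x (Γ.edgePoint e t) := fun e a => by
    simp only [intervalIntegral.integral_of_le (Γ.len_pos e).le]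
    exact (integrable_uncurry_of_continuous_right
      (H := fun x t => Γ.resistance x (Γ.edgePoint e t)) (fun t => (hr _).measurable)
      (fun x => (hr' x).comp (continuous_edgePoint e)) (fun x t => hC x _)
      _ _).integral_prod_left.const_mul a
  have hsmul : ∀ (a : ℝ) (f : Γ.Point → ℝ), ∫ᵛ x, a * f x ∂•μ = a * ∫ᵛ x, f x ∂•μ := fun a f =>
    VectorMeasure.integral_fun_smul μ (ContinuousLinearMap.lsmul ℝ ℝ) a f
  have h1 : ∫ᵛ _x, D ∂•μ = D := by rw [integral_const_signedMeasure, hμ1, mul_one]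
  have h2 : ∫ᵛ _x, D ∂•μ = c := by
    -- The constant D is expanded as an integral of r(x, ·) against the explicit measure;
    -- integrating in x against μ first turns each r into c, and the explicit measure has mass 1.
    rw [VectorMeasure.integral_congr_ae (.of_forall hexp),
      VectorMeasure.integral_fun_add
        (VectorMeasure.Integrable.fun_finsetSum _ fun v _ => hvint v _)
        (VectorMeasure.Integrable.fun_finsetSum _ fun e _ => heint e _),
      VectorMeasure.integral_finsetSum _ fun v _ => hvint v _,
      VectorMeasure.integral_finsetSum _ fun e _ => heint e _]
    have hswap : ∀ e, ∫ᵛ x, (∫ t in 0..Γ.len e, Γ.resistance x (Γ.edgePoint e t)) ∂•μ =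
        Γ.len e * c := fun e => by
      rw [integral_signedMeasure_intervalIntegral_comm μ
        (H := fun x t => Γ.resistance x (Γ.edgePoint e t)) (fun t => (hr _).measurable)
        (fun x => (hr' x).comp (continuous_edgePoint e)) (fun x t => hC x _) (Γ.len_pos e).le]
      simp [hμr]
    simp only [hsmul, hμr, hswap]
    have hmass := hG.explicitCanonicalMeasure_univ
    rw [MetrizedGraph.explicitCanonicalMeasure_univ] at hmass
    rw [← Finset.sum_mul]
    conv_rhs => rw [← one_mul c, ← hmass, add_mul]
    rw [add_right_inj, Finset.sum_mul]
    refine Finset.sum_congr rfl fun e _ => ?_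
    have := (Γ.len_pos e).ne'
    field_simp
  rw [hc, ← h1, h2]

/-- Existence of a canonical measure and agreement of the constants suffice; uniqueness of the
measure itself is not needed. -/
theorem tau_eq (hG : Γ.IsGreen p G) (hΓ : Γ.Connected) :
    Γ.tau = 1 / 2 * ∫ᵛ ζ, Γ.pointGreen G ζ ζ ∂•(Γ.explicitCanonicalMeasure G) := by
  have hcan : Γ.IsCanonicalMeasure Γ.canonicalMeasure :=
    Classical.epsilon_spec ⟨_, hG.isCanonicalMeasure hΓ⟩
  have h : ∀ x, 1 / 2 * Γ.measureVoltage Γ.canonicalMeasure x x = Γ.tau :=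
    Classical.epsilon_spec (p := fun t : ℝ => ∀ x,
      1 / 2 * Γ.measureVoltage Γ.canonicalMeasure x x = t)
      ⟨_, fun x => by rw [hG.measureVoltage_eq hΓ hcan x]⟩
  rw [← h (.vertex p), hG.measureVoltage_eq hΓ hcan]

/-! ### Evaluation of the terms of the formula in terms of `G`. -/

theorem integral_pointGreen_diag (hG : Γ.IsGreen p G) :
    ∫ᵛ ζ, Γ.pointGreen G ζ ζ ∂•(Γ.explicitCanonicalMeasure G) =
      ∑ v, (1 - Γ.degree v / 2) * G v v + ∑ e, (1 - Γ.edgeGap G e / Γ.len e) *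
        ((G (Γ.src e) (Γ.src e) + G (Γ.tgt e) (Γ.tgt e)) / 2 +
          (Γ.len e - Γ.edgeGap G e) / 6) := by
  rw [integral_explicitCanonicalMeasure hG.continuous_pointGreen_diag]
  simp only [pointGreen_vertex_right, interp]
  congr 1
  refine Finset.sum_congr rfl fun e _ => ?_
  have hL := Γ.len_pos e
  -- a, b and -k are the coefficients of the quadratic polynomial of `pointGreen_diag` on e.
  obtain ⟨a, ha⟩ : ∃ a, a = G (Γ.src e) (Γ.src e) := ⟨_, rfl⟩
  obtain ⟨b, hb⟩ : ∃ b, b = (G (Γ.tgt e) (Γ.tgt e) - a) / Γ.len e +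
    (Γ.len e - Γ.edgeGap G e) / Γ.len e := ⟨_, rfl⟩
  obtain ⟨k, hk⟩ : ∃ k, k = (Γ.len e - Γ.edgeGap G e) / Γ.len e ^ 2 := ⟨_, rfl⟩
  have h : ∫ t in 0..Γ.len e, Γ.pointGreen G (Γ.edgePoint e t) (Γ.edgePoint e t) =
      ∫ t in 0..Γ.len e, (a + (b * t - k * t ^ 2)) :=
    intervalIntegral.integral_congr fun t ht => by
      rw [uIcc_of_le hL.le] at ht
      rw [hG.pointGreen_diag ht, interp_edgePoint _ ht, hb, hk, ha]
      field_simp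
      ring
  rw [h, integral_quadratic, hb, hk, ← ha]
  field_simp
  ring

theorem resistance_vertex (hG : Γ.IsGreen p G) (hΓ : Γ.Connected) (v : V) :
    Γ.resistance (.vertex p) (.vertex v) = G v v := by
  rw [hG.resistance_eq hΓ, hG.pointGreen_base, hG.pointGreen_base, pointGreen_vertex_right]
  simp [interp]

/-- The rank-one update gives R = rL/(L - r), which is the parallel law r = LR/(L + R). -/
theorem len_div_len_add_edgeResistance (hG : Γ.IsGreen p G) {e : E}
    (he : (Γ.deleteEdge e).Connected) :
    Γ.len e / (Γ.len e + Γ.edgeResistance e) = 1 - Γ.edgeGap G e / Γ.len e := by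
  have hne := sub_ne_zero.mpr (hG.edgeGap_ne_len he).symm
  have hL := (Γ.len_pos e).ne'
  have hR : Γ.edgeResistance e =
      Γ.edgeGap G e * Γ.len e / (Γ.len e - Γ.edgeGap G e) := by
    rw [edgeResistance, (hG.deleteEdge he).resistance_eq he, pointGreen_vertex_right,
      pointGreen_vertex_right, pointGreen_vertex_right]
    simp only [interp]
    rw [hG.symm (Γ.tgt e) (Γ.src e)]
    generalize hr : Γ.edgeGap G e = r at *
    rw [edgeGap] at hr
    field_simp
    rw [← hr]
    ring
  have h : Γ.len e + Γ.edgeResistance e = Γ.len e ^ 2 / (Γ.len e - Γ.edgeGap G e) := by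
    rw [hR]; field_simp; ring
  rw [h]
  field_simp

/-- With reference point `p` the voltage of Γ - e is its Green function, all terms involving `p`
being zero. -/
theorem resistanceC_eq (hG : Γ.IsGreen p G) {e : E} (he : (Γ.deleteEdge e).Connected) :
    Γ.resistanceC e p = G (Γ.src e) (Γ.tgt e) +
        (G (Γ.tgt e) (Γ.src e) - G (Γ.tgt e) (Γ.tgt e)) / (Γ.len e - Γ.edgeGap G e) *
        (G (Γ.src e) (Γ.src e) - G (Γ.src e) (Γ.tgt e)) := by
  have hH := hG.deleteEdge he
  rw [resistanceC, hH.voltage_eq he, hH.pointGreen_base, hH.pointGreen_base,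
    hH.pointGreen_comm _ (.vertex p), hH.pointGreen_base, pointGreen_vertex_right]
  simp [interp]

end IsGreen

end MetrizedGraph
end

theorem mainTheorem10 {V E : Type*} [Fintype V] [Fintype E] (Γ : MetrizedGraph V E)
    (hΓ : Γ.Bridgeless) (p : V) :
    Γ.tau = Γ.totalLength / 12
      - (1 / 6) * ∑ q : V, ((Γ.valence (.vertex q) : ℝ) - 2) *
          Γ.resistance (.vertex p) (.vertex q)
      + (1 / 3) * ∑ e : E, Γ.len e / (Γ.len e + Γ.edgeResistance e) * Γ.resistanceC e p := by
  obtain ⟨hc, hb⟩ := hΓ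
  obtain ⟨G, hG⟩ := hc.exists_isGreen p
  simp only [MetrizedGraph.cast_valence_vertex, hG.resistance_vertex hc,
    hG.len_div_len_add_edgeResistance (hb _), hG.resistanceC_eq (hb _)]
  rw [hG.tau_eq hc, hG.integral_pointGreen_diag,
    hG.tau_identity fun e => hG.edgeGap_ne_len (hb e), MetrizedGraph.totalLength]
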